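/- Let $O$ be a finite set of objects and $I$ a nonempty finite set of agents. An allocation problem consists of quantities $q_l>0$ ($l\in O$) and, for every agent $i\in I$, a maximum overall demand $c^i>0$ with consumption space $C^i=\{x\in\mathbf{R}^O_+:\sum_{l}x_l\le c^i\}$, a utility function $u^i:\mathbf{R}^O\to\mathbf{R}\cup\{-\infty\}$ whose domain $\{x : u^i(x)>-\infty\}$ is $C^i$ and which on $C^i$ is continuous and monotone (if $x,y\in C^i$, $x\le y$ coordinatewise and $x\ne y$, then $u^i(x)<u^i(y)$), and a reservation utility $\tilde u^i\in\mathbf{R}$. It is assumed that $\sum_{l}q_l\le\sum_i c^i$. An allocation is a vector $x=(x^i)_{i\in I}$ with $x^i\in C^i$ for all $i$ and $\sum_i x^i_l=q_l$ for all $l$. An allocation $x$ is individually rational (IR) if $u^i(x^i)\ge\tilde u^i$ for all $i$; weakly Pareto optimal if there is no allocation $y$ with $u^i(y^i)>u^i(x^i)$ for all $i$; Pareto optimal if there is no allocation $y$ with $u^i(y^i)\ge u^i(x^i)$ for all $i$ and strict inequality for some $i$. It has no strong justified envy if there are no two distinct agents $i,j$ with $u^i(x^j)>u^i(x^i)$ and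 $u^j(x^i)>\tilde u^j$. For $\varepsilon>0$, $x$ is $\varepsilon$-individually rational if $u^i(x^i)\ge\tilde u^i-\varepsilon$ for all $i$; $\varepsilon$-Pareto optimal if there is no allocation $y$ with $u^i(y^i)>u^i(x^i)+\varepsilon$ for all $i$; and it has no $\varepsilon$-justified envy if there are no two distinct agents $i,j$ with $u^i(x^j)>u^i(x^i)$ and $u^j(x^i)>\tilde u^j-\varepsilon$. Theorem. Suppose that every $u^i$ is concave, that is, $\lambda u^i(z)+(1-\lambda)u^i(x)\le u^i(\lambda z+(1-\lambda)x)$ for all $x,z\in\mathbf{R}^O$ and $\lambda\in(0,1)$ (with the usual conventions for $-\infty$), and that an IR allocation exists. 1. For every $\varepsilon>0$ there exists an allocation that is $\varepsilon$-individually rational, $\varepsilon$-Pareto optimal and has no $\varepsilon$-justified envy. 2. There exists an allocation that is individually rational, weakly Pareto optimal and has no strong justified envy. 3. If every utility is linear (for each $i$ there is $v^i\in\mathbf{R}^O$ with $u^i(x)=v^i\cdot x$ for all $x\in C^i$), there exists an allocation that is individually rational, Pareto optimal and has no strong justified envy. -/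

import Mathlib

/-- The consumption space of an agent with maximum overall demand `c`: the nonnegative bundles
whose total quantity is at most `c`. -/
def consumptionSpace {O : Type*} [Fintype O] (c : ℝ) : Set (O → ℝ) :=
  {x | (∀ l, 0 ≤ x l) ∧ ∑ l, x l ≤ c}

/-- An allocation problem with set of objects `O` and set of agents `I`. Utilities take values in
`ℝ ∪ {-∞}`, realized as the extended reals without `⊤`; the domain of a utility is the set
where it is not `-∞`. Bundles are compared coordinatewise, so `x < y` means that
`x l ≤ y l` for all `l` and `x ≠ y`. -/
structure AllocationProblem (O I : Type*) [Fintype O] [Fintype I] where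
  /-- quantity of each object -/
  q : O → ℝ
  q_pos : ∀ l, 0 < q l
  /-- maximum overall demand of each agent -/
  c : I → ℝ
  c_pos : ∀ i, 0 < c i
  /-- no overall excess supply -/
  sum_q_le : ∑ l, q l ≤ ∑ i, c i
  /-- utility functions -/
  u : I → (O → ℝ) → EReal
  u_ne_top : ∀ i x, u i x ≠ ⊤
  domain_u : ∀ i, {x | ⊥ < u i x} = consumptionSpace (c i)
  continuous_u : ∀ i, ContinuousOn (u i) (consumptionSpace (c i))
  monotone_u : ∀ i, StrictMonoOn (u i) (consumptionSpace (c i))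
  /-- reservation utilities -/
  r : I → ℝ

/-- Concavity of a function with values in `ℝ ∪ {-∞}`. -/
def IsConcaveUtility {O : Type*} (u : (O → ℝ) → EReal) : Prop :=
  ∀ x z : O → ℝ, ∀ a : ℝ, 0 < a → a < 1 →
    (a : EReal) * u z + ((1 - a : ℝ) : EReal) * u x ≤ u (a • z + (1 - a) • x)

/-- Linearity of a function with values in `ℝ ∪ {-∞}`: it is given by a vector on its domain. -/
def IsLinearUtility {O : Type*} [Fintype O] (u : (O → ℝ) → EReal) : Prop :=
  ∃ v : O → ℝ, ∀ x, ⊥ < u x → u x = ((∑ l, v l * x l : ℝ) : EReal)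

namespace AllocationProblem

variable {O I : Type*} [Fintype O] [Fintype I]

/-- Allocations: every agent gets a bundle in her consumption space, and supply is exhausted. -/
def IsAllocation (Γ : AllocationProblem O I) (x : I → O → ℝ) : Prop :=
  (∀ i, x i ∈ consumptionSpace (Γ.c i)) ∧ ∀ l, ∑ i, x i l = Γ.q l

/-- Individual rationality. -/
def IsIR (Γ : AllocationProblem O I) (x : I → O → ℝ) : Prop :=
  ∀ i, (Γ.r i : EReal) ≤ Γ.u i (x i)

/-- Weak Pareto optimality. -/
def IsWeaklyPO (Γ : AllocationProblem O I) (x : I → O → ℝ) : Prop :=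
  ¬ ∃ y, Γ.IsAllocation y ∧ ∀ i, Γ.u i (x i) < Γ.u i (y i)

/-- Pareto optimality. -/
def IsPO (Γ : AllocationProblem O I) (x : I → O → ℝ) : Prop :=
  ¬ ∃ y, Γ.IsAllocation y ∧ (∀ i, Γ.u i (x i) ≤ Γ.u i (y i)) ∧ ∃ i, Γ.u i (x i) < Γ.u i (y i)

/-- Agent `i` has strong justified envy towards agent `j` at `x`. -/
def HasStrongJustifiedEnvy (Γ : AllocationProblem O I) (x : I → O → ℝ) (i j : I) : Prop :=
  Γ.u i (x i) < Γ.u i (x j) ∧ (Γ.r j : EReal) < Γ.u j (x i)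

/-- No strong justified envy. -/
def NoStrongJustifiedEnvy (Γ : AllocationProblem O I) (x : I → O → ℝ) : Prop :=
  ¬ ∃ i j, i ≠ j ∧ Γ.HasStrongJustifiedEnvy x i j

/-- `ε`-individual rationality. -/
def IsEpsIR (Γ : AllocationProblem O I) (ε : ℝ) (x : I → O → ℝ) : Prop :=
  ∀ i, ((Γ.r i - ε : ℝ) : EReal) ≤ Γ.u i (x i)

/-- `ε`-Pareto optimality. -/
def IsEpsPO (Γ : AllocationProblem O I) (ε : ℝ) (x : I → O → ℝ) : Prop :=
  ¬ ∃ y, Γ.IsAllocation y ∧ ∀ i, Γ.u i (x i) + (ε : EReal) < Γ.u i (y i)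

/-- No `ε`-justified envy. -/
def NoEpsJustifiedEnvy (Γ : AllocationProblem O I) (ε : ℝ) (x : I → O → ℝ) : Prop :=
  ¬ ∃ i j, i ≠ j ∧ Γ.u i (x i) < Γ.u i (x j) ∧ ((Γ.r j - ε : ℝ) : EReal) < Γ.u j (x i)

end AllocationProblem

/-!
Fix weights on the agents and consider an allocation `x` of maximal weighted welfare. Let `S` be the
set of agents of positive weight. Then `x` is Pareto optimal for `S`, the others being disregarded
(`IsParetoOn`), and some member of `S` neither falls short of her reservation utility nor has
justified envy (`IsParetoOn.exists_violation_eq_zero`). Indeed, some members of `S` reach their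
reservation utilities since an individually rational allocation exists. If one of them, `i`, has
justified envy of an agent `j` who is disregarded or below her reservation utility, swapping the
bundles of `i` and `j` is an improvement for `S`. So if all of them had justified envy, their envy
would run along a cycle, and exchanging bundles along that cycle would be an improvement. Bundles
that do not fit into the consumption space of the receiver are scaled down, and leftovers are
absorbed by the agents with slack, as there is no overall excess supply
(`exists_isAllocation_ge`). Utilities are extended to all bundles by this scaling (`value`),
which makes the absence of justified envy a closed condition.

It remains to choose the weights so that no agent has a complaint. Measure the complaints of agent
`i` at `x` by a continuous `violation i x ≥ 0`. A fixed point argument provides weights `t` in the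
simplex and a welfare maximizer `x` with `violation i x = t i * ∑ k, violation k x` for all `i`
(`exists_isMaxOn_eq_mul_sum`). An agent of positive weight without violation then forces the sum to
vanish. The fixed point argument perturbs welfare by a small strictly concave term, so that the
maximizer is a continuous function of the weights, applies a form of Brouwer's theorem
(`exists_mem_stdSimplex_eq_mul_sum`) and passes to the limit. Brouwer's theorem is deduced from
Scarf's combinatorial lemma (`exists_dominant_rainbow`), by counting incidences of rooms and doors
modulo two.

This yields individual rationality, weak Pareto optimality and the absence of strong justified envy;
the statement for `ε` is the same with reservation utilities lowered by `ε`. For linear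
utilities, use the weights `exp (n * t i)` instead and let `n → ∞`. As the allocations form a
polytope, an improvement upon the limit would be a feasible direction of improvement at the
approximating maximizers (`eventually_isAllocation_add_half`). So the limit is Pareto optimal, and
it is also Pareto optimal for the agents with positive limit of `t i`, whose weights dominate all
the others exponentially, so that the argument above applies.
-/

/-! ### Scarf's combinatorial lemma -/

/-- A set `σ` is dominant for a family of rankings if no element is ranked above the
lowest element of `σ` in every ranking. Below, rooms are the dominant sets with as many elements as
there are rankings, and doors are the sets with one element less. -/
def IsDominant {I T L : Type*} [LinearOrder L] (rank : I → T → L) (σ : Finset T) : Prop :=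
  ∀ y, ∃ i, ∀ x ∈ σ, rank i y ≤ rank i x

lemma IsDominant.mono {I T L : Type*} [LinearOrder L] {rank : I → T → L} {σ τ : Finset T}
    (h : IsDominant rank σ) (hτ : τ ⊆ σ) : IsDominant rank τ := fun y =>
  (h y).imp fun _ hi x hx => hi x (hτ hx)

section Scarf

variable {I T L : Type*} [LinearOrder L]

/-- `y` is the best candidate, in ranking `k`, among the elements that beat `m l` in
every ranking `l ≠ k`. If the `m l` are the lowest elements of a dominant door and `k` shares its
lowest element with another ranking, adding `y` to the door yields a room. -/
def IsBestCandidate (rank : I → T → L) (m : I → T) (k : I) (y : T) : Prop :=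
  (∀ l, l ≠ k → rank l (m l) < rank l y) ∧
    ∀ z, (∀ l, l ≠ k → rank l (m l) < rank l z) → rank k z ≤ rank k y

lemma exists_isBestCandidate [Fintype T] {rank : I → T → L} {m : I → T} {k : I} {z : T}
    (hz : ∀ l, l ≠ k → rank l (m l) < rank l z) : ∃ y, IsBestCandidate rank m k y := by
  classical
  obtain ⟨y, hy, hmax⟩ := Finset.exists_max_image
    (Finset.univ.filter fun z => ∀ l, l ≠ k → rank l (m l) < rank l z) (rank k)
    ⟨z, by simpa using hz⟩
  simp only [Finset.mem_filter, Finset.mem_univ, true_and] at hy hmax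
  exact ⟨y, hy, hmax⟩

lemma IsBestCandidate.unique {rank : I → T → L} (hrank : ∀ i, Function.Injective (rank i))
    {m : I → T} {k : I} {y z : T} (hy : IsBestCandidate rank m k y)
    (hz : IsBestCandidate rank m k z) : y = z :=
  hrank k (le_antisymm (hz.2 y hy.1) (hy.2 z hz.1))

/-- The rooms containing a door `τ`, in which the rankings `i` and `j` have the same lowest
element, arise by adding a best candidate for `i` or for `j`. -/
lemma isDominant_insert_iff [Fintype I] [DecidableEq I] [DecidableEq T] {rank : I → T → L}
    (hrank : ∀ i, Function.Injective (rank i))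
    {τ : Finset T} (hτ : IsDominant rank τ) (hcard : τ.card + 1 = Fintype.card I)
    {m : I → T} (hm : ∀ i, m i ∈ τ) (hmin : ∀ i, ∀ x ∈ τ, rank i (m i) ≤ rank i x)
    {i j : I} (hij : i ≠ j) (hmij : m i = m j) (y : T) :
    (y ∉ τ ∧ IsDominant rank (insert y τ)) ↔
      (IsBestCandidate rank m i y ∨ IsBestCandidate rank m j y) := by
  have hsurj : ∀ x ∈ τ, ∃ k, m k = x := by
    intro x hx
    obtain ⟨k, hk⟩ := hτ x
    exact ⟨k, hrank k (le_antisymm (hmin k x hx) (hk _ (hm k)))⟩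
  -- `m` maps the rankings other than `k` bijectively onto `τ`, for `k = i` and for `k = j`
  have hinj : ∀ k k', k ≠ k' → m k = m k' → Set.InjOn m (Finset.univ.erase k : Finset I) := by
    intro k k' hkk hmk
    apply Finset.injOn_of_card_image_eq
    have : (Finset.univ.erase k).image m = τ := by
      ext x
      simp only [Finset.mem_image, Finset.mem_erase, Finset.mem_univ, and_true]
      constructor
      · rintro ⟨l, -, rfl⟩
        exact hm l
      · intro hx
        obtain ⟨l, rfl⟩ := hsurj x hx
        by_cases hl : l = k
        · exact ⟨k', hkk.symm, by rw [hl, hmk]⟩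
        · exact ⟨l, hl, rfl⟩
    rw [this, Finset.card_erase_of_mem (Finset.mem_univ _), Finset.card_univ]
    omega
  have hpair : ∀ l p, m l = m p → l ≠ p → (l = i ∨ l = j) ∧ (p = i ∨ p = j) := by
    intro l p hlp hne
    have h1 := hinj i j hij hmij
    have h2 := hinj j i hij.symm hmij.symm
    have e1 : l = i ∨ p = i := by
      by_contra! h
      exact hne (h1 (by simpa using h.1) (by simpa using h.2) hlp)
    have e2 : l = j ∨ p = j := by
      by_contra! h
      exact hne (h2 (by simpa using h.1) (by simpa using h.2) hlp)
    grind
  -- the converse, for one of the two rankings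
  have key : ∀ k k', k ≠ k' → m k = m k' → IsBestCandidate rank m k y →
      y ∉ τ ∧ IsDominant rank (insert y τ) := by
    intro k k' hkk hmk hy
    refine ⟨fun hyτ => ?_, fun z => ?_⟩
    · obtain ⟨l, rfl⟩ := hsurj y hyτ
      by_cases hl : l = k
      · subst hl
        have := hy.1 k' hkk.symm
        rw [hmk] at this
        exact lt_irrefl _ this
      · exact lt_irrefl _ (hy.1 l hl)
    · by_cases hz : ∀ l, l ≠ k → rank l (m l) < rank l z
      · obtain ⟨p, hp⟩ := hτ z
        have hpk : p = k := by
          by_contra h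
          exact absurd (hp _ (hm p)) (not_le.2 (hz p h))
        subst hpk
        refine ⟨p, fun x hx => ?_⟩
        rcases Finset.mem_insert.1 hx with rfl | hx
        · exact hy.2 z hz
        · exact hp x hx
      · push Not at hz
        obtain ⟨l, hl, hlz⟩ := hz
        refine ⟨l, fun x hx => ?_⟩
        rcases Finset.mem_insert.1 hx with rfl | hx
        · exact hlz.trans (hy.1 l hl).le
        · exact hlz.trans (hmin l x hx)
  constructor
  · rintro ⟨hyτ, hdom⟩
    have hne : ∀ l, m l ≠ y := fun l h => hyτ (h ▸ hm l)
    obtain ⟨k, hk⟩ := hdom y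
    have hk' : rank k y ≤ rank k (m k) := hk _ (Finset.mem_insert_of_mem (hm k))
    -- every element of `τ` is still lowest in some ranking
    have hstay : ∀ l, ∃ p, m p = m l ∧ rank p (m p) < rank p y := by
      intro l
      obtain ⟨p, hp⟩ := hdom (m l)
      have h1 : m p = m l := hrank p (le_antisymm (hmin p _ (hm l))
        (hp _ (Finset.mem_insert_of_mem (hm p))))
      refine ⟨p, h1, lt_of_le_of_ne ?_ fun h => hne p (hrank p h)⟩
      rw [h1]
      exact hp y (Finset.mem_insert_self _ _)
    have hkij : k = i ∨ k = j := by
      obtain ⟨p, hp, hlt⟩ := hstay k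
      have : k ≠ p := by
        rintro rfl
        exact absurd hk' (not_le.2 hlt)
      exact (hpair k p hp.symm this).1
    have htop : IsBestCandidate rank m k y := by
      constructor
      · intro l hl
        obtain ⟨p, hp, hlt⟩ := hstay l
        by_cases hpl : p = l
        · exact hpl ▸ hlt
        · have h1 := hpair p l hp hpl
          have : p = k := by grind
          subst this
          exact absurd hk' (not_le.2 hlt)
      · intro z hz
        obtain ⟨p, hp⟩ := hdom z
        have hpk : p = k := by
          by_contra h
          exact absurd (hp _ (Finset.mem_insert_of_mem (hm p))) (not_le.2 (hz p h))
        subst hpk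
        exact hp y (Finset.mem_insert_self _ _)
    rcases hkij with rfl | rfl
    · exact Or.inl htop
    · exact Or.inr htop
  · rintro (h | h)
    · exact key i j hij hmij h
    · exact key j i hij.symm hmij.symm h

/-- A door lies in as many rooms as there are best candidates for the two rankings in which it
has the same lowest element. -/
lemma card_rooms_of_door [Fintype I] [DecidableEq I] [DecidableEq T] {rank : I → T → L}
    (hrank : ∀ i, Function.Injective (rank i))
    {τ : Finset T} (hτ : IsDominant rank τ) (hcard : τ.card + 1 = Fintype.card I)
    {m : I → T} (hm : ∀ i, m i ∈ τ) (hmin : ∀ i, ∀ x ∈ τ, rank i (m i) ≤ rank i x)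
    {i j : I} (hij : i ≠ j) (hmij : m i = m j) (R : Finset (Finset T))
    (hR : ∀ σ, σ ∈ R ↔ IsDominant rank σ ∧ σ.card = Fintype.card I) (A B : Finset T)
    (hA : ∀ y, y ∈ A ↔ IsBestCandidate rank m i y) (hB : ∀ y, y ∈ B ↔ IsBestCandidate rank m j y) :
    (R.filter fun σ => τ ⊆ σ).card = A.card + B.card := by
  have hiff := isDominant_insert_iff hrank hτ hcard hm hmin hij hmij
  have hdisj : Disjoint A B := by
    rw [Finset.disjoint_left]
    intro y hyA hyB
    rw [hA] at hyA
    rw [hB] at hyB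
    obtain ⟨p, hp⟩ := hτ y
    have := hp _ (hm p)
    by_cases h : p = i
    · exact absurd this (not_le.2 (hyB.1 p (h ▸ hij)))
    · exact absurd this (not_le.2 (hyA.1 p h))
  have himage : (R.filter fun σ => τ ⊆ σ) = (A ∪ B).image fun y => insert y τ := by
    ext σ
    simp only [Finset.mem_filter, Finset.mem_image, Finset.mem_union, hA, hB, hR, ← hiff]
    constructor
    · rintro ⟨⟨hdom, hσ⟩, hτσ⟩
      obtain ⟨y, hy⟩ : ∃ y, σ \ τ = {y} := by
        rw [← Finset.card_eq_one, Finset.card_sdiff_of_subset hτσ]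
        omega
      have hyσ : insert y τ = σ := by
        rw [Finset.insert_eq, ← hy, Finset.sdiff_union_of_subset hτσ]
      have : y ∈ σ \ τ := by simp [hy]
      exact ⟨y, ⟨(Finset.mem_sdiff.1 this).2, hyσ ▸ hdom⟩, hyσ⟩
    · rintro ⟨y, ⟨hy, hdom⟩, rfl⟩
      exact ⟨⟨hdom, by rw [Finset.card_insert_of_notMem hy, hcard]⟩, Finset.subset_insert _ _⟩
  rw [himage, Finset.card_image_of_injOn, Finset.card_union_of_disjoint hdisj]
  intro y hy z hz hyz
  have hy' : y ∉ τ := by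
    simp only [Finset.coe_union, Set.mem_union, Finset.mem_coe, hA, hB, ← hiff] at hy
    exact hy.1
  have : y ∈ insert z τ := by
    have h : insert y τ = insert z τ := hyz
    rw [← h]
    exact Finset.mem_insert_self _ _
  exact (Finset.mem_insert.1 this).resolve_right hy'

/-- A room with all colors contains one door with all colors but `a`; any other room contains
none or two. -/
lemma odd_card_doors_iff [Fintype I] [DecidableEq I] [DecidableEq T] {c : T → I} (a : I)
    {σ : Finset T} (hσ : σ.card = Fintype.card I)
    (D : Finset (Finset T))
    (hD : ∀ τ, τ ∈ D ↔ τ.card + 1 = Fintype.card I ∧ τ.image c = Finset.univ.erase a) :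
    Odd (D.filter fun τ => τ ⊆ σ).card ↔ σ.image c = Finset.univ := by
  have hform : ∀ τ ∈ D.filter (fun τ => τ ⊆ σ), ∃ x ∈ σ, τ = σ.erase x := by
    intro τ hτ
    obtain ⟨hτD, hτσ⟩ := Finset.mem_filter.1 hτ
    obtain ⟨y, hy⟩ : ∃ y, σ \ τ = {y} := by
      rw [← Finset.card_eq_one, Finset.card_sdiff_of_subset hτσ]
      have := ((hD τ).1 hτD).1
      omega
    refine ⟨y, (Finset.mem_sdiff.1 (by simp [hy] : y ∈ σ \ τ)).1, ?_⟩
    rw [Finset.erase_eq, ← hy, Finset.sdiff_sdiff_eq_self hτσ]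
  have hcardI : 0 < Fintype.card I := Fintype.card_pos_iff.2 ⟨a⟩
  constructor
  · intro hodd
    by_contra hrain
    obtain ⟨τ, hτ⟩ := Finset.card_pos.1 hodd.pos
    obtain ⟨x, hx, rfl⟩ := hform τ hτ
    obtain ⟨hcard, himg⟩ := (hD _).1 (Finset.mem_filter.1 hτ).1
    have hinj : Set.InjOn c (σ.erase x : Finset T) := by
      apply Finset.injOn_of_card_image_eq
      rw [himg, Finset.card_erase_of_mem (Finset.mem_univ _), Finset.card_univ]
      omega
    have hins : σ.image c = insert (c x) (Finset.univ.erase a) := by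
      rw [← himg, ← Finset.image_insert, Finset.insert_erase hx]
    have hxa : c x ≠ a := by
      intro h
      rw [h, Finset.insert_erase (Finset.mem_univ _)] at hins
      exact hrain hins
    have : c x ∈ (σ.erase x).image c := by
      rw [himg]
      simpa using hxa
    obtain ⟨x', hx', hcx'⟩ := Finset.mem_image.1 this
    obtain ⟨hne, hx'σ⟩ := Finset.mem_erase.1 hx'
    have hins' : insert (c x) (Finset.univ.erase a) = Finset.univ.erase a :=
      Finset.insert_eq_of_mem (by simpa using hxa)
    have hset : (D.filter fun τ => τ ⊆ σ) = {σ.erase x, σ.erase x'} := by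
      ext τ
      simp only [Finset.mem_insert, Finset.mem_singleton]
      constructor
      · intro h
        obtain ⟨z, hz, rfl⟩ := hform τ h
        by_contra! hcon
        have hzx : z ≠ x := fun h => hcon.1 (h ▸ rfl)
        have hzx' : z ≠ x' := fun h => hcon.2 (h ▸ rfl)
        have himgz := ((hD _).1 (Finset.mem_filter.1 h).1).2
        have hcz : c z ∈ (σ.erase z).image c := by
          rw [himgz, ← himg]
          exact Finset.mem_image_of_mem c (Finset.mem_erase.2 ⟨hzx, hz⟩)
        obtain ⟨w, hw, hcw⟩ := Finset.mem_image.1 hcz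
        obtain ⟨hwz, hwσ⟩ := Finset.mem_erase.1 hw
        by_cases hwx : w = x
        · rw [hwx, ← hcx'] at hcw
          exact hzx' (hinj (by simp [hne, hx'σ]) (by simp [hzx, hz]) hcw).symm
        · exact hwz (hinj (by simp [hwx, hwσ]) (by simp [hzx, hz]) hcw)
      · rintro (rfl | rfl)
        · exact hτ
        · refine Finset.mem_filter.2 ⟨(hD _).2 ⟨?_, ?_⟩, Finset.erase_subset _ _⟩
          · rw [Finset.card_erase_of_mem hx'σ]
            omega
          · rw [← hins', ← hins]
            refine le_antisymm (Finset.image_subset_image (Finset.erase_subset _ _)) ?_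
            intro k hk
            obtain ⟨w, hw, rfl⟩ := Finset.mem_image.1 hk
            by_cases hwx : w = x'
            · rw [hwx, hcx']
              exact Finset.mem_image_of_mem c (Finset.mem_erase.2 ⟨hne.symm, hx⟩)
            · exact Finset.mem_image_of_mem c (Finset.mem_erase.2 ⟨hwx, hw⟩)
    have hne2 : σ.erase x ≠ σ.erase x' := by
      intro h
      have := h ▸ hx'
      simp at this
    rw [hset, Finset.card_pair hne2] at hodd
    exact absurd hodd (by decide)
  · intro hrain
    have hinj : Set.InjOn c (σ : Finset T) := by
      apply Finset.injOn_of_card_image_eq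
      rw [hrain, Finset.card_univ, hσ]
    obtain ⟨x, hx, hxa⟩ := Finset.mem_image.1 (by rw [hrain]; simp : a ∈ σ.image c)
    have hset : (D.filter fun τ => τ ⊆ σ) = {σ.erase x} := by
      ext τ
      simp only [Finset.mem_singleton]
      constructor
      · intro h
        obtain ⟨z, hz, rfl⟩ := hform τ h
        have himgz := ((hD _).1 (Finset.mem_filter.1 h).1).2
        by_contra hcon
        have hxz : x ≠ z := fun h => hcon (h ▸ rfl)
        have : a ∈ (σ.erase z).image c := by
          rw [← hxa]
          exact Finset.mem_image_of_mem c (Finset.mem_erase.2 ⟨hxz, hx⟩)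
        rw [himgz] at this
        simp at this
      · rintro rfl
        refine Finset.mem_filter.2 ⟨(hD _).2 ⟨?_, ?_⟩, Finset.erase_subset _ _⟩
        · rw [Finset.card_erase_of_mem hx]
          omega
        · ext k
          simp only [Finset.mem_image, Finset.mem_erase, Finset.mem_univ, and_true]
          constructor
          · rintro ⟨w, ⟨hwx, hw⟩, rfl⟩ h
            exact hwx (hinj hw hx (h.trans hxa.symm))
          · intro hk
            obtain ⟨w, hw, rfl⟩ := Finset.mem_image.1 (by rw [hrain]; simp : k ∈ σ.image c)
            exact ⟨w, ⟨fun h => hk (by rw [h, hxa]), hw⟩, rfl⟩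
    rw [hset, Finset.card_singleton]
    exact odd_one

/-- **Scarf's lemma.** Let `T` be ranked by each `i : I`, and let `s i` be lowest in ranking `i`
and above all the elements outside the range of `s` in the other rankings. If `s i` has color `i`,
some dominant set with as many elements as there are colors has all the colors. -/
theorem exists_dominant_rainbow [Fintype I] [DecidableEq I] [Nontrivial I] [Fintype T]
    [DecidableEq T] {rank : I → T → L}
    (hrank : ∀ i, Function.Injective (rank i)) (s : I → T)
    (hlow : ∀ i y, rank i (s i) ≤ rank i y)
    (hhigh : ∀ i k y, i ≠ k → y ∉ Set.range s → rank k y < rank k (s i))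
    (c : T → I) (hc : ∀ i, c (s i) = i) :
    ∃ σ : Finset T, IsDominant rank σ ∧ σ.image c = Finset.univ := by
  classical
  obtain ⟨a⟩ : Nonempty I := inferInstance
  set R : Finset (Finset T) :=
    Finset.univ.filter fun σ => IsDominant rank σ ∧ σ.card = Fintype.card I with hRdef
  set D : Finset (Finset T) := Finset.univ.filter fun τ =>
    τ.card + 1 = Fintype.card I ∧ τ.image c = Finset.univ.erase a with hDdef
  have hR : ∀ σ, σ ∈ R ↔ IsDominant rank σ ∧ σ.card = Fintype.card I := by simp [hRdef]
  have hD : ∀ τ, τ ∈ D ↔ τ.card + 1 = Fintype.card I ∧ τ.image c = Finset.univ.erase a := by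
    simp [hDdef]
  have hs : Function.Injective s := fun i j h => by rw [← hc i, ← hc j, h]
  have hcardI : 1 < Fintype.card I := Fintype.one_lt_card
  set τ₀ : Finset T := (Finset.univ.erase a).image s with hτ₀
  have hτ₀D : τ₀ ∈ D := by
    rw [hD, hτ₀, Finset.card_image_of_injective _ hs, Finset.card_erase_of_mem (Finset.mem_univ _),
      Finset.card_univ, Finset.image_image]
    refine ⟨by omega, ?_⟩
    have : c ∘ s = id := funext hc
    rw [this, Finset.image_id]
  -- the lowest elements of a door
  have hlowest : ∀ τ ∈ D, ∃ m : I → T, (∀ i, m i ∈ τ) ∧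
      ∀ i, ∀ x ∈ τ, rank i (m i) ≤ rank i x := by
    intro τ hτ
    have hne : τ.Nonempty := by
      rw [← Finset.card_pos]
      have := ((hD τ).1 hτ).1
      omega
    choose m hm hmin using fun i => Finset.exists_min_image τ (rank i) hne
    exact ⟨m, hm, hmin⟩
  have hone : ∀ (m : I → T) (k : I) (z : T), (∀ l, l ≠ k → rank l (m l) < rank l z) →
      (Finset.univ.filter fun y => IsBestCandidate rank m k y).card = 1 := by
    intro m k z hz
    obtain ⟨y, hy⟩ := exists_isBestCandidate hz
    rw [Finset.card_eq_one]
    refine ⟨y, ?_⟩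
    ext y'
    simp only [Finset.mem_filter, Finset.mem_univ, true_and, Finset.mem_singleton]
    exact ⟨fun h => h.unique hrank hy, fun h => h ▸ hy⟩
  have hdoor : ∀ τ ∈ D, (Odd (R.filter fun σ => τ ⊆ σ).card ↔ τ = τ₀) := by
    intro τ hτ
    obtain ⟨hcard, himg⟩ := (hD τ).1 hτ
    obtain ⟨m, hm, hmin⟩ := hlowest τ hτ
    constructor
    · intro hodd
      by_contra hne
      obtain ⟨t, htτ, ht⟩ : ∃ t ∈ τ, t ∉ Set.range s := by
        by_contra! h
        apply hne
        ext x
        simp only [hτ₀, Finset.mem_image, Finset.mem_erase, Finset.mem_univ, and_true]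
        constructor
        · intro hx
          obtain ⟨i, rfl⟩ := h x hx
          refine ⟨i, ?_, rfl⟩
          have := Finset.mem_image_of_mem c hx
          rw [himg, hc] at this
          simpa using this
        · rintro ⟨i, hi, rfl⟩
          have : i ∈ τ.image c := by rw [himg]; simpa using hi
          obtain ⟨x, hx, hcx⟩ := Finset.mem_image.1 this
          obtain ⟨k, rfl⟩ := h x hx
          rw [hc] at hcx
          exact hcx ▸ hx
      obtain ⟨σ, hσ⟩ := Finset.card_pos.1 hodd.pos
      obtain ⟨hσR, hτσ⟩ := Finset.mem_filter.1 hσ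
      have hdom : IsDominant rank τ := ((hR σ).1 hσR).1.mono hτσ
      obtain ⟨i, -, j, -, hij, hmij⟩ := Finset.exists_ne_map_eq_of_card_lt_of_maps_to
        (s := (Finset.univ : Finset I)) (t := τ) (f := m)
        (by rw [Finset.card_univ]; omega) (fun i _ => hm i)
      have hcand : ∀ k l, l ≠ k → rank l (m l) < rank l (s k) := fun k l hl =>
        (hmin l t htτ).trans_lt (hhigh k l t hl.symm ht)
      rw [card_rooms_of_door hrank hdom hcard hm hmin hij hmij R hR
        (Finset.univ.filter fun y => IsBestCandidate rank m i y)
        (Finset.univ.filter fun y => IsBestCandidate rank m j y) (by simp) (by simp),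
        hone m i (s i) (hcand i), hone m j (s j) (hcand j)] at hodd
      exact absurd hodd (by decide)
    · intro hττ
      have hmem : ∀ i, i ≠ a → s i ∈ τ := fun i hi => by
        rw [hττ, hτ₀]
        exact Finset.mem_image_of_mem s (by simpa using hi)
      have hms : ∀ i, i ≠ a → m i = s i := fun i hi =>
        hrank i (le_antisymm (hmin i _ (hmem i hi)) (hlow i _))
      obtain ⟨b, hb, hmb⟩ : ∃ b, b ≠ a ∧ m a = s b := by
        have := hm a
        rw [hττ, hτ₀] at this
        obtain ⟨b, hb, hmb⟩ := Finset.mem_image.1 this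
        exact ⟨b, by simpa using hb, hmb.symm⟩
      have hdom : IsDominant rank τ := by
        intro y
        by_cases hy : y ∈ Set.range s
        · obtain ⟨k, rfl⟩ := hy
          exact ⟨k, fun x _ => hlow k x⟩
        · refine ⟨a, fun x hx => ?_⟩
          rw [hττ, hτ₀] at hx
          obtain ⟨k, hk, rfl⟩ := Finset.mem_image.1 hx
          exact (hhigh k a y (by simpa using hk) hy).le
      have hB : (Finset.univ.filter fun y => IsBestCandidate rank m b y).card = 0 := by
        rw [Finset.card_eq_zero, Finset.filter_eq_empty_iff]
        rintro y - hy
        have h1 := hy.1 a hb.symm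
        rw [hmb] at h1
        by_cases hys : y ∈ Set.range s
        · obtain ⟨k, rfl⟩ := hys
          by_cases hka : k = a
          · rw [hka] at h1
            exact absurd (hlow a (s b)) (not_le.2 h1)
          by_cases hkb : k = b
          · rw [hkb] at h1
            exact lt_irrefl _ h1
          have h2 := hy.1 k hkb
          rw [hms k hka] at h2
          exact lt_irrefl _ h2
        · exact absurd h1 (hhigh b a y hb hys).not_gt
      rw [card_rooms_of_door hrank hdom hcard hm hmin hb.symm (hmb.trans (hms b hb).symm) R hR
        (Finset.univ.filter fun y => IsBestCandidate rank m a y)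
        (Finset.univ.filter fun y => IsBestCandidate rank m b y) (by simp) (by simp), hB,
        hone m a (s a) fun l hl => ?_]
      · exact odd_one
      · rw [hms l hl]
        exact lt_of_le_of_ne (hlow l _) fun h => hl (hs (hrank l h))
  have hodd : Odd (∑ σ ∈ R, (D.filter fun τ => τ ⊆ σ).card) := by
    have := Finset.sum_card_bipartiteAbove_eq_sum_card_bipartiteBelow
      (s := R) (t := D) (fun σ τ => τ ⊆ σ)
    simp only [Finset.bipartiteAbove, Finset.bipartiteBelow] at this
    rw [this, Finset.odd_sum_iff_odd_card_odd, Finset.filter_congr hdoor,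
      Finset.filter_eq' D τ₀, if_pos hτ₀D, Finset.card_singleton]
    exact odd_one
  obtain ⟨σ, hσ, hσodd⟩ : ∃ σ ∈ R, Odd (D.filter fun τ => τ ⊆ σ).card := by
    by_contra! h
    exact (Nat.not_odd_iff_even.2 (Finset.even_sum _ fun σ hσ =>
      Nat.not_odd_iff_even.1 (h σ hσ))) hodd
  exact ⟨σ, ((hR σ).1 hσ).1, (odd_card_doors_iff a ((hR σ).1 hσ).2 D hD).1 hσodd⟩

end Scarf

/-! ### A fixed point theorem on the standard simplex -/

/-- Scarf's lemma on the grid of step `1 / N` in the simplex, in integral coordinates: for any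
coloring `c`, there are grid points `p i`, close to one another, such that `p i` has color `i` or is
close to the face opposite to the vertex `i`. -/
lemma exists_close_grid_points {I : Type*} [Fintype I] [Nontrivial I] (N : ℕ)
    (c : (I → ℕ) → I) :
    ∃ (μ : I → ℕ) (p : I → I → ℕ), ∀ i, ∑ k, p i k = N ∧
      (∀ k, μ k ≤ p i k ∧ p i k ≤ μ k + Fintype.card I) ∧
      (c (p i) = i ∨ p i i ≤ Fintype.card I) := by
  classical
  let G := {a : I → ℕ // a ∈ Finset.piAntidiag (Finset.univ : Finset I) N}
  have hG : ∀ a : G, ∑ k, a.1 k = N := fun a => (Finset.mem_piAntidiag.1 a.2).1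
  -- the element `inr i` stands for the face opposite to the vertex `i`
  let pos : G ⊕ I → I → ℕ := fun y k =>
    Sum.elim (fun a : G => a.1 k + 1) (fun i => if k = i then 0 else N + 2) y
  -- ties between coordinates are broken by an enumeration
  let rank : I → G ⊕ I → ℕ ×ₗ Fin (Fintype.card (G ⊕ I)) := fun k y =>
    toLex (pos y k, Fintype.equivFin (G ⊕ I) y)
  have hle : ∀ k y z, rank k y ≤ rank k z → pos y k ≤ pos z k := fun k y z h => by
    rcases (Prod.Lex.toLex_le_toLex).1 h with h | h
    · exact h.le
    · exact h.1.le
  obtain ⟨σ, hdom, hcol⟩ := exists_dominant_rainbow (rank := rank)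
    (fun i y z h => by
      have h2 := congrArg (fun w => (ofLex w).2) h
      exact (Fintype.equivFin (G ⊕ I)).injective h2)
    Sum.inr
    (fun i y => by
      by_cases h : y = Sum.inr i
      · rw [h]
      · refine (Prod.Lex.toLex_le_toLex).2 (Or.inl ?_)
        rcases y with a | j
        · simp [pos]
        · have : i ≠ j := fun hij => h (by rw [hij])
          simp [pos, this])
    (fun i k y hik hy => by
      refine (Prod.Lex.toLex_lt_toLex).2 (Or.inl ?_)
      rcases y with a | j
      · have h1 : a.1 k ≤ ∑ k, a.1 k := Finset.single_le_sum (by simp) (Finset.mem_univ k)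
        rw [hG] at h1
        simp only [pos, Sum.elim_inl, Sum.elim_inr, if_neg hik.symm]
        omega
      · exact absurd ⟨j, rfl⟩ hy)
    (Sum.elim (fun a => c a.1) id) (fun i => rfl)
  -- the faces outside `σ` are those whose color is taken by a grid point
  have hgrid : ∀ i, Sum.inr i ∉ σ → ∃ a : G, Sum.inl a ∈ σ ∧ c a.1 = i := by
    intro i hi
    obtain ⟨y, hy, hyi⟩ := Finset.mem_image.1 (by rw [hcol]; simp :
      i ∈ σ.image (Sum.elim (fun a : G => c a.1) id))
    rcases y with a | j
    · exact ⟨a, hy, hyi⟩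
    · have : j = i := hyi
      exact absurd (this ▸ hy) hi
  have hdomG : ∀ a : G, ∃ i, Sum.inr i ∉ σ ∧ ∀ b : G, Sum.inl b ∈ σ → a.1 i ≤ b.1 i := by
    intro a
    obtain ⟨i, hi⟩ := hdom (Sum.inl a)
    refine ⟨i, fun h => ?_, fun b hb => ?_⟩
    · have := hle _ _ _ (hi _ h)
      simp [pos] at this
    · have := hle _ _ _ (hi _ hb)
      simpa [pos] using this
  obtain ⟨i₀⟩ : Nonempty I := inferInstance
  obtain ⟨b₀, hb₀⟩ : ∃ b : G, Sum.inl b ∈ σ := by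
    let a₀ : G := ⟨Pi.single i₀ N, by simp [Finset.mem_piAntidiag]⟩
    obtain ⟨i, hi, -⟩ := hdomG a₀
    obtain ⟨a, ha, -⟩ := hgrid i hi
    exact ⟨a, ha⟩
  let σ' : Finset G := Finset.univ.filter fun a => Sum.inl a ∈ σ
  have hσ' : ∀ a, a ∈ σ' ↔ Sum.inl a ∈ σ := by simp [σ']
  have hmin : ∀ k, ∃ a ∈ σ', ∀ b ∈ σ', a.1 k ≤ b.1 k := fun k =>
    Finset.exists_min_image σ' (fun a => a.1 k) ⟨b₀, (hσ' _).2 hb₀⟩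
  choose lo hlo hlo_le using hmin
  let μ : I → ℕ := fun k => if Sum.inr k ∈ σ then 0 else (lo k).1 k
  have hμ : ∀ a ∈ σ', ∀ k, μ k ≤ a.1 k := by
    intro a ha k
    by_cases hk : Sum.inr k ∈ σ
    · simp [μ, hk]
    · simpa [μ, hk] using hlo_le k a ha
  -- otherwise some grid point would be above `μ` in all the coordinates
  have hsum : N ≤ ∑ k, μ k + Fintype.card I := by
    by_contra! hlt
    have hS : ∑ k, (μ k + 1) < N := by
      rw [Finset.sum_add_distrib]
      simpa using hlt
    let a : G := ⟨fun k => μ k + 1 + (Pi.single i₀ (N - ∑ k, (μ k + 1)) : I → ℕ) k, by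
      rw [Finset.mem_piAntidiag]
      refine ⟨?_, by simp⟩
      rw [Finset.sum_add_distrib, Finset.sum_pi_single']
      simp only [Finset.mem_univ, if_true]
      omega⟩
    obtain ⟨i, hi, hai⟩ := hdomG a
    have h1 := hai (lo i) ((hσ' _).1 (hlo i))
    have h2 : μ i = (lo i).1 i := by simp [μ, hi]
    have h3 : μ i + 1 ≤ a.1 i := Nat.le_add_right _ _
    omega
  have hupper : ∀ a ∈ σ', ∀ k, a.1 k ≤ μ k + Fintype.card I := by
    intro a ha k
    have h1 : ∑ l ∈ Finset.univ.erase k, μ l ≤ ∑ l ∈ Finset.univ.erase k, a.1 l :=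
      Finset.sum_le_sum fun l _ => hμ a ha l
    have h2 := Finset.add_sum_erase Finset.univ μ (Finset.mem_univ k)
    have h3 := Finset.add_sum_erase Finset.univ a.1 (Finset.mem_univ k)
    have h4 := hG a
    omega
  have hp : ∀ i, ∃ a ∈ σ', c a.1 = i ∨ a.1 i ≤ Fintype.card I := by
    intro i
    by_cases hi : Sum.inr i ∈ σ
    · refine ⟨b₀, (hσ' _).2 hb₀, Or.inr ?_⟩
      have := hupper b₀ ((hσ' _).2 hb₀) i
      simpa [μ, hi] using this
    · obtain ⟨a, ha, hai⟩ := hgrid i hi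
      exact ⟨a, (hσ' _).2 ha, Or.inl hai⟩
  choose p hpσ hpc using hp
  exact ⟨μ, fun i => (p i).1, fun i =>
    ⟨hG _, fun k => ⟨hμ _ (hpσ i) k, hupper _ (hpσ i) k⟩, hpc i⟩⟩

/-- A form of Brouwer's theorem: nonnegative continuous functions on the simplex are proportional
to the coordinates at some point. -/
theorem exists_mem_stdSimplex_eq_mul_sum {I : Type*} [Fintype I] [Nonempty I]
    (g : I → (I → ℝ) → ℝ) (hg : ∀ i, ContinuousOn (g i) (stdSimplex ℝ I))
    (hnonneg : ∀ i, ∀ t ∈ stdSimplex ℝ I, 0 ≤ g i t) :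
    ∃ t ∈ stdSimplex ℝ I, ∀ i, g i t = t i * ∑ k, g k t := by
  classical
  rcases subsingleton_or_nontrivial I with hI | hI
  · obtain ⟨a⟩ : Nonempty I := inferInstance
    refine ⟨Pi.single a 1, single_mem_stdSimplex ℝ a, fun i => ?_⟩
    have hi : i = a := Subsingleton.elim _ _
    have hu : (Finset.univ : Finset I) = {a} := by
      ext k
      simp [Subsingleton.elim k a]
    rw [hi, hu]
    simp
  set h : I → (I → ℝ) → ℝ := fun i t => t i * ∑ k, g k t - g i t with hh
  have hcont : ∀ i, ContinuousOn (h i) (stdSimplex ℝ I) := fun i =>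
    ((continuous_apply i).continuousOn.mul (continuousOn_finsetSum _ fun k _ => hg k)).sub (hg i)
  have hzero : ∀ t ∈ stdSimplex ℝ I, ∑ i, h i t = 0 := by
    intro t ht
    simp only [hh, Finset.sum_sub_distrib, ← Finset.sum_mul, ht.2, one_mul, sub_self]
  -- the color of a grid point is a coordinate that is not too large compared with `g`
  have hcolor : ∀ t : I → ℝ, ∃ i, t ∈ stdSimplex ℝ I → h i t ≤ 0 := by
    intro t
    by_cases ht : t ∈ stdSimplex ℝ I
    · obtain ⟨i, -, hi⟩ := Finset.exists_le_of_sum_le (s := (Finset.univ : Finset I))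
        (f := fun i => h i t) (g := fun _ => 0) Finset.univ_nonempty (by simp [hzero t ht])
      exact ⟨i, fun _ => hi⟩
    · exact ⟨Classical.arbitrary I, fun h => absurd h ht⟩
  choose col hcol using hcolor
  let pt : ℕ → (I → ℕ) → I → ℝ := fun n a k => (a k : ℝ) / (n + 1)
  have hpt : ∀ n a, ∑ k, a k = n + 1 → pt n a ∈ stdSimplex ℝ I := by
    intro n a ha
    refine ⟨fun k => by positivity, ?_⟩
    simp only [pt]
    rw [← Finset.sum_div, ← Nat.cast_sum, ha]
    push_cast
    exact div_self (by positivity)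
  choose μ p hp using fun n : ℕ => exists_close_grid_points (n + 1) fun a => col (pt n a)
  have hmem : ∀ n i, pt n (p n i) ∈ stdSimplex ℝ I := fun n i => hpt n _ (hp n i).1
  obtain ⟨i₀⟩ : Nonempty I := inferInstance
  obtain ⟨t, ht, φ, hφ, hlim⟩ := (isCompact_stdSimplex ℝ I).tendsto_subseq fun n => hmem n i₀
  have hsmall : Filter.Tendsto (fun n => (Fintype.card I : ℝ) / ((φ n : ℝ) + 1)) Filter.atTop
      (nhds 0) := by
    have h1 : Filter.Tendsto (fun n : ℕ => (Fintype.card I : ℝ) / ((n : ℝ) + 1)) Filter.atTop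
        (nhds 0) := by
      have := (tendsto_one_div_add_atTop_nhds_zero_nat (𝕜 := ℝ)).const_mul (Fintype.card I : ℝ)
      simpa [div_eq_mul_inv] using this
    exact h1.comp hφ.tendsto_atTop
  have hlim' : ∀ i, Filter.Tendsto (fun n => pt (φ n) (p (φ n) i)) Filter.atTop
      (nhds t) := by
    intro i
    rw [tendsto_pi_nhds] at hlim ⊢
    intro k
    have hdiff : Filter.Tendsto (fun n => pt (φ n) (p (φ n) i) k - pt (φ n) (p (φ n) i₀) k)
        Filter.atTop (nhds 0) := by
      refine squeeze_zero_norm (fun n => ?_) hsmall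
      have h1 := (hp (φ n) i).2.1 k
      have h2 := (hp (φ n) i₀).2.1 k
      have h3 : (p (φ n) i k : ℝ) ≤ p (φ n) i₀ k + Fintype.card I := by
        exact_mod_cast h1.2.trans (Nat.add_le_add_right h2.1 _)
      have h4 : (p (φ n) i₀ k : ℝ) ≤ p (φ n) i k + Fintype.card I := by
        exact_mod_cast h2.2.trans (Nat.add_le_add_right h1.1 _)
      simp only [pt]
      rw [← sub_div, Real.norm_eq_abs, abs_div, abs_of_pos (by positivity : (0:ℝ) < φ n + 1)]
      gcongr
      rw [abs_le]
      constructor <;> linarith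
    simpa using hdiff.add (hlim k)
  have hbound : ∀ i n, min (h i (pt (φ n) (p (φ n) i))) (pt (φ n) (p (φ n) i) i) ≤
      (Fintype.card I : ℝ) / ((φ n : ℝ) + 1) := by
    intro i n
    rcases (hp (φ n) i).2.2 with hc | hc
    · refine (min_le_left _ _).trans (le_trans ?_ (by positivity : (0:ℝ) ≤ _))
      have := hcol _ (hmem (φ n) i)
      rwa [hc] at this
    · refine (min_le_right _ _).trans ?_
      simp only [pt]
      gcongr
  have hle : ∀ i, h i t ≤ 0 := by
    intro i
    have h1 : Filter.Tendsto (fun n => h i (pt (φ n) (p (φ n) i))) Filter.atTop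
        (nhds (h i t)) :=
      (hcont i t ht).tendsto.comp (tendsto_nhdsWithin_iff.2
        ⟨hlim' i, Filter.Eventually.of_forall fun n => hmem _ i⟩)
    have h2 := le_of_tendsto_of_tendsto' (h1.min (tendsto_pi_nhds.1 (hlim' i) i)) hsmall (hbound i)
    rcases min_le_iff.1 h2 with h3 | h3
    · exact h3
    · have h4 : t i = 0 := le_antisymm h3 (ht.1 i)
      simp only [hh, h4, zero_mul, zero_sub]
      linarith [hnonneg i t ht]
  refine ⟨t, ht, fun i => ?_⟩
  have := (Finset.sum_eq_zero_iff_of_nonpos fun i _ => hle i).1 (hzero t ht) i (Finset.mem_univ i)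
  simp only [hh] at this
  linarith

/-! ### Maximizers of parametrized concave functions -/

/-- Limits of maximizers, up to an error `r`, of continuously parametrized objectives are
maximizers. -/
lemma isMaxOn_of_tendsto {A E ι : Type*} [TopologicalSpace A] [TopologicalSpace E]
    {S : Set A} {K : Set E} {F : A → E → ℝ}
    (hF : ContinuousOn (Function.uncurry F) (S ×ˢ K)) {l : Filter ι} [l.NeBot]
    {τ : ι → A} {ξ : ι → E} {t : A} {x : E} (hτS : ∀ᶠ n in l, τ n ∈ S) (hξK : ∀ᶠ n in l, ξ n ∈ K)
    (ht : t ∈ S) (hx : x ∈ K) (hτ : Filter.Tendsto τ l (nhds t))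
    (hξ : Filter.Tendsto ξ l (nhds x)) {r : ι → E → ℝ}
    (hr : ∀ z ∈ K, Filter.Tendsto (fun n => r n z) l (nhds 0))
    (hmax : ∀ᶠ n in l, ∀ z ∈ K, F (τ n) z ≤ F (τ n) (ξ n) + r n z) :
    IsMaxOn (F t) K x := by
  intro z hz
  have h1 : Filter.Tendsto (fun n => F (τ n) z) l (nhds (F t z)) :=
    (hF (t, z) ⟨ht, hz⟩).tendsto.comp (f := fun n => (τ n, z)) (tendsto_nhdsWithin_iff.2
      ⟨hτ.prodMk_nhds tendsto_const_nhds, hτS.mono fun n hn => ⟨hn, hz⟩⟩)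
  have h2 : Filter.Tendsto (fun n => F (τ n) (ξ n)) l (nhds (F t x)) :=
    (hF (t, x) ⟨ht, hx⟩).tendsto.comp (f := fun n => (τ n, ξ n)) (tendsto_nhdsWithin_iff.2
      ⟨hτ.prodMk_nhds hξ, (hτS.and hξK).mono fun n hn => ⟨hn.1, hn.2⟩⟩)
  have h3 := h2.add (hr z hz)
  rw [add_zero] at h3
  exact le_of_tendsto_of_tendsto h1 h3 (hmax.mono fun n hn => hn z hz)

/-- For strictly concave objectives the maximizer depends continuously on the parameter, so that
the fixed point theorem applies to `d` at the maximizer. -/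
lemma exists_isMaxOn_eq_mul_sum_of_strictConcaveOn {I E : Type*} [Fintype I] [Nonempty I]
    [NormedAddCommGroup E] [NormedSpace ℝ E] {K : Set E} (hK : IsCompact K) (hne : K.Nonempty)
    (F : (I → ℝ) → E → ℝ)
    (hF : ContinuousOn (Function.uncurry F) (stdSimplex ℝ I ×ˢ K))
    (hconc : ∀ t ∈ stdSimplex ℝ I, StrictConcaveOn ℝ K (F t))
    (d : I → E → ℝ) (hd : ∀ i, ContinuousOn (d i) K) (hd0 : ∀ i, ∀ x ∈ K, 0 ≤ d i x) :
    ∃ t ∈ stdSimplex ℝ I, ∃ x ∈ K, IsMaxOn (F t) K x ∧ ∀ i, d i x = t i * ∑ k, d k x := by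
  have hex : ∀ t : I → ℝ, ∃ x ∈ K, t ∈ stdSimplex ℝ I → IsMaxOn (F t) K x := by
    intro t
    by_cases ht : t ∈ stdSimplex ℝ I
    · obtain ⟨x, hx, hmax⟩ := hK.exists_isMaxOn hne (f := F t)
        (hF.comp (f := fun x => (t, x)) (by fun_prop) fun x hx => ⟨ht, hx⟩)
      exact ⟨x, hx, fun _ => hmax⟩
    · obtain ⟨x, hx⟩ := hne
      exact ⟨x, hx, fun h => absurd h ht⟩
  choose f hfK hfmax using hex
  have hf : ContinuousOn f (stdSimplex ℝ I) := by
    intro t ht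
    refine hK.tendsto_nhds_of_unique_mapClusterPt (Filter.Eventually.of_forall hfK) ?_
    intro x hx hclus
    obtain ⟨U, hU, hlim⟩ := mapClusterPt_iff_ultrafilter.1 hclus
    have hmem : ∀ᶠ s in (U : Filter (I → ℝ)), s ∈ stdSimplex ℝ I :=
      hU self_mem_nhdsWithin
    have hmax : IsMaxOn (F t) K x := isMaxOn_of_tendsto hF (l := (U : Filter (I → ℝ)))
      (τ := id) (ξ := f) (r := 0) hmem (Filter.Eventually.of_forall hfK) ht hx
      (hU.trans nhdsWithin_le_nhds) hlim (fun _ _ => tendsto_const_nhds)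
      (hmem.mono fun s hs z hz => by simpa using hfmax s hs hz)
    exact (hconc t ht).eq_of_isMaxOn hmax (hfmax t ht) hx (hfK t)
  obtain ⟨t, ht, h⟩ := exists_mem_stdSimplex_eq_mul_sum (fun i t => d i (f t))
    (fun i => (hd i).comp hf fun t _ => hfK t) (fun i t _ => hd0 i _ (hfK t))
  exact ⟨t, ht, f t, hfK t, hfmax t ht, h⟩

/-- Some parameter `t` and some maximizer of the concave objective `F t` are such that the
nonnegative quantities `d i` at the maximizer are proportional to the `t i`. -/
theorem exists_isMaxOn_eq_mul_sum {I E : Type*} [Fintype I] [Nonempty I]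
    [NormedAddCommGroup E] [NormedSpace ℝ E] {K : Set E} (hK : IsCompact K) (hne : K.Nonempty)
    (F : (I → ℝ) → E → ℝ)
    (hF : ContinuousOn (Function.uncurry F) (stdSimplex ℝ I ×ˢ K))
    (hconc : ∀ t ∈ stdSimplex ℝ I, ConcaveOn ℝ K (F t))
    {G : E → ℝ} (hG : ContinuousOn G K) (hGconc : StrictConcaveOn ℝ K G)
    (d : I → E → ℝ) (hd : ∀ i, ContinuousOn (d i) K) (hd0 : ∀ i, ∀ x ∈ K, 0 ≤ d i x) :
    ∃ t ∈ stdSimplex ℝ I, ∃ x ∈ K, IsMaxOn (F t) K x ∧ ∀ i, d i x = t i * ∑ k, d k x := by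
  -- perturb the objective by a small multiple of `G`
  have hstep : ∀ n : ℕ, ∃ p ∈ stdSimplex ℝ I ×ˢ K,
      IsMaxOn (fun x => F p.1 x + 1 / ((n : ℝ) + 1) * G x) K p.2 ∧
        ∀ i, d i p.2 = p.1 i * ∑ k, d k p.2 := by
    intro n
    have hpos : (0 : ℝ) < 1 / ((n : ℝ) + 1) := by positivity
    obtain ⟨t, ht, x, hx, h⟩ := exists_isMaxOn_eq_mul_sum_of_strictConcaveOn hK hne
      (fun t x => F t x + 1 / ((n : ℝ) + 1) * G x)
      (hF.add (continuousOn_const.mul (hG.comp continuousOn_snd fun p hp => hp.2)))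
      (fun t ht => (hconc t ht).add_strictConcaveOn
        ⟨hGconc.1, fun x hx y hy hxy a b ha hb hab => by
          have := mul_lt_mul_of_pos_left (hGconc.2 hx hy hxy ha hb hab) hpos
          simp only [smul_eq_mul] at this ⊢
          linarith⟩) d hd hd0
    exact ⟨(t, x), ⟨ht, hx⟩, h⟩
  choose p hp hmax heq using hstep
  obtain ⟨⟨t, x⟩, ⟨ht, hx⟩, φ, hφ, hlim⟩ :=
    ((isCompact_stdSimplex ℝ I).prod hK).tendsto_subseq hp
  have hlim1 : Filter.Tendsto (fun n => (p (φ n)).1) Filter.atTop (nhds t) :=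
    (continuous_fst.tendsto _).comp hlim
  have hlim2 : Filter.Tendsto (fun n => (p (φ n)).2) Filter.atTop (nhds x) :=
    (continuous_snd.tendsto _).comp hlim
  have hlim2' : Filter.Tendsto (fun n => (p (φ n)).2) Filter.atTop (nhdsWithin x K) :=
    tendsto_nhdsWithin_iff.2 ⟨hlim2, Filter.Eventually.of_forall fun n => (hp _).2⟩
  have hsmall : Filter.Tendsto (fun n => 1 / ((φ n : ℝ) + 1)) Filter.atTop (nhds 0) :=
    (tendsto_one_div_add_atTop_nhds_zero_nat (𝕜 := ℝ)).comp hφ.tendsto_atTop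
  refine ⟨t, ht, x, hx, ?_, fun i => ?_⟩
  · refine isMaxOn_of_tendsto hF (τ := fun n => (p (φ n)).1) (ξ := fun n => (p (φ n)).2)
      (r := fun n z => 1 / ((φ n : ℝ) + 1) * (G (p (φ n)).2 - G z))
      (Filter.Eventually.of_forall fun n => (hp _).1)
      (Filter.Eventually.of_forall fun n => (hp _).2) ht hx hlim1 hlim2 (fun z _ => ?_)
      (Filter.Eventually.of_forall fun n z hz => ?_)
    · have := hsmall.mul (((hG x hx).tendsto.comp hlim2').sub_const (G z))
      rwa [zero_mul] at this
    · have := isMaxOn_iff.1 (hmax (φ n)) z hz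
      linarith
  · have hdlim : ∀ k, Filter.Tendsto (fun n => d k (p (φ n)).2) Filter.atTop (nhds (d k x)) :=
      fun k => (hd k x hx).tendsto.comp hlim2'
    refine tendsto_nhds_unique (hdlim i) ?_
    simp only [heq _ i]
    exact (tendsto_pi_nhds.1 hlim1 i).mul (tendsto_finsetSum _ fun k _ => hdlim k)

lemma exists_pos_of_mem_stdSimplex {I : Type*} [Fintype I] {t : I → ℝ}
    (ht : t ∈ stdSimplex ℝ I) : ∃ i, 0 < t i := by
  by_contra! h
  linarith [ht.2, Finset.sum_nonpos fun i (_ : i ∈ Finset.univ) => h i]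

/-! ### Utilities extended to all nonnegative bundles -/

section Rescale

variable {O : Type*} [Fintype O]

/-- The bundle `x`, scaled down if necessary so that its total quantity is at most `c`. -/
noncomputable def rescale (c : ℝ) (x : O → ℝ) : O → ℝ := (c / max c (∑ l, x l)) • x

lemma rescale_mem {c : ℝ} (hc : 0 < c) {x : O → ℝ} (hx : 0 ≤ x) :
    rescale c x ∈ consumptionSpace c := by
  have hmax : 0 < max c (∑ l, x l) := lt_max_of_lt_left hc
  refine ⟨fun l => mul_nonneg (by positivity) (hx l), ?_⟩
  simp only [rescale, Pi.smul_apply, smul_eq_mul]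
  rw [← Finset.mul_sum, div_mul_eq_mul_div, div_le_iff₀ hmax]
  exact mul_le_mul_of_nonneg_left (le_max_right _ _) hc.le

lemma rescale_le {c : ℝ} (hc : 0 < c) {x : O → ℝ} (hx : 0 ≤ x) : rescale c x ≤ x := by
  intro l
  have hmax : 0 < max c (∑ l, x l) := lt_max_of_lt_left hc
  exact mul_le_of_le_one_left (hx l) ((div_le_one hmax).2 (le_max_left _ _))

lemma rescale_of_mem {c : ℝ} (hc : 0 < c) {x : O → ℝ} (hx : x ∈ consumptionSpace c) :
    rescale c x = x := by
  rw [rescale, max_eq_left hx.2, div_self hc.ne', one_smul]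

lemma continuous_rescale {c : ℝ} (hc : 0 < c) : Continuous (rescale c : (O → ℝ) → O → ℝ) := by
  have h : Continuous fun x : O → ℝ => c / max c (∑ l, x l) :=
    continuous_const.div (by fun_prop) fun x => (lt_max_of_lt_left hc).ne'
  exact h.smul continuous_id

end Rescale

namespace AllocationProblem

section Value

variable {O I : Type*} [Fintype O] [Fintype I] (Γ : AllocationProblem O I)

/-- The real-valued extension of the utility of agent `i` to nonnegative bundles: a bundle that is
too large for her is scaled down to her consumption space. -/
noncomputable def value (i : I) (x : O → ℝ) : ℝ := (Γ.u i (rescale (Γ.c i) x)).toReal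

variable {Γ}

lemma mem_consumptionSpace_iff {i : I} {x : O → ℝ} :
    x ∈ consumptionSpace (Γ.c i) ↔ ⊥ < Γ.u i x := by
  rw [← Γ.domain_u i]
  rfl

lemma coe_value_of_mem {i : I} {x : O → ℝ} (hx : x ∈ consumptionSpace (Γ.c i)) :
    (Γ.value i x : EReal) = Γ.u i x := by
  rw [value, rescale_of_mem (Γ.c_pos i) hx]
  exact EReal.coe_toReal (Γ.u_ne_top i x) (mem_consumptionSpace_iff.1 hx).ne'

lemma value_rescale {i : I} {x : O → ℝ} (hx : 0 ≤ x) :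
    Γ.value i (rescale (Γ.c i) x) = Γ.value i x := by
  rw [value, rescale_of_mem (Γ.c_pos i) (rescale_mem (Γ.c_pos i) hx), value]

lemma value_mono {i : I} {x y : O → ℝ} (hx : x ∈ consumptionSpace (Γ.c i))
    (hy : y ∈ consumptionSpace (Γ.c i)) (hxy : x ≤ y) : Γ.value i x ≤ Γ.value i y := by
  rw [← EReal.coe_le_coe_iff, coe_value_of_mem hx, coe_value_of_mem hy]
  exact (Γ.monotone_u i).monotoneOn hx hy hxy

lemma continuousOn_value (i : I) : ContinuousOn (Γ.value i) {x | 0 ≤ x} := by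
  refine EReal.continuousOn_toReal.comp ((Γ.continuous_u i).comp
    (continuous_rescale (Γ.c_pos i)).continuousOn fun x hx => rescale_mem (Γ.c_pos i) hx) ?_
  intro x hx
  have h := mem_consumptionSpace_iff.1 (rescale_mem (Γ.c_pos i) hx)
  simp only [Set.mem_compl_iff, Set.mem_insert_iff, Set.mem_singleton_iff,
    not_or]
  exact ⟨h.ne', Γ.u_ne_top i _⟩

lemma value_concave {i : I} (hu : IsConcaveUtility (Γ.u i)) {x y : O → ℝ}
    (hx : x ∈ consumptionSpace (Γ.c i)) (hy : y ∈ consumptionSpace (Γ.c i)) {a b : ℝ}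
    (ha : 0 ≤ a) (hb : 0 ≤ b) (hab : a + b = 1)
    (hxy : a • x + b • y ∈ consumptionSpace (Γ.c i)) :
    a * Γ.value i x + b * Γ.value i y ≤ Γ.value i (a • x + b • y) := by
  rcases ha.eq_or_lt with rfl | ha
  · simp [show b = 1 by linarith]
  rcases hb.eq_or_lt with rfl | hb
  · simp [show a = 1 by linarith]
  have h := hu y x a ha (by linarith)
  rw [show 1 - a = b by linarith, ← coe_value_of_mem hx, ← coe_value_of_mem hy,
    ← coe_value_of_mem hxy] at h
  exact_mod_cast h

lemma exists_value_eq_sum {i : I} (hu : IsLinearUtility (Γ.u i)) :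
    ∃ v : O → ℝ, ∀ x ∈ consumptionSpace (Γ.c i), Γ.value i x = ∑ l, v l * x l := by
  obtain ⟨v, hv⟩ := hu
  refine ⟨v, fun x hx => ?_⟩
  have h := hv x (mem_consumptionSpace_iff.1 hx)
  rw [← coe_value_of_mem hx] at h
  exact_mod_cast h

end Value

/-! ### The set of allocations -/

section Allocations

variable {O I : Type*} [Fintype O] [Fintype I] {Γ : AllocationProblem O I}

lemma IsAllocation.nonneg {x : I → O → ℝ} (hx : Γ.IsAllocation x) (i : I) : 0 ≤ x i :=
  (hx.1 i).1

variable (Γ) in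
lemma convex_isAllocation : Convex ℝ {x | Γ.IsAllocation x} := by
  intro x hx y hy a b ha hb hab
  refine ⟨fun i => ⟨fun l => ?_, ?_⟩, fun l => ?_⟩
  · exact add_nonneg (mul_nonneg ha ((hx.1 i).1 l)) (mul_nonneg hb ((hy.1 i).1 l))
  · simp only [Pi.add_apply, Pi.smul_apply, smul_eq_mul, Finset.sum_add_distrib, ← Finset.mul_sum]
    calc a * ∑ l, x i l + b * ∑ l, y i l ≤ a * Γ.c i + b * Γ.c i := by
          gcongr
          · exact (hx.1 i).2
          · exact (hy.1 i).2
      _ = Γ.c i := by rw [← add_mul, hab, one_mul]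
  · simp only [Pi.add_apply, Pi.smul_apply, smul_eq_mul, Finset.sum_add_distrib, ← Finset.mul_sum,
      hx.2 l, hy.2 l]
    rw [← add_mul, hab, one_mul]

variable (Γ) in
lemma isCompact_isAllocation : IsCompact {x | Γ.IsAllocation x} := by
  refine (isCompact_Icc (a := (0 : I → O → ℝ)) (b := fun i _ => Γ.c i)).of_isClosed_subset ?_ ?_
  · have h : {x | Γ.IsAllocation x} = (⋂ i, ⋂ l, {x : I → O → ℝ | 0 ≤ x i l}) ∩
        (⋂ i, {x : I → O → ℝ | ∑ l, x i l ≤ Γ.c i}) ∩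
        ⋂ l, {x : I → O → ℝ | ∑ i, x i l = Γ.q l} := by
      ext x
      simp [IsAllocation, consumptionSpace, forall_and]
    rw [h]
    refine ((isClosed_iInter fun i => isClosed_iInter fun l => ?_).inter
      (isClosed_iInter fun i => ?_)).inter (isClosed_iInter fun l => ?_)
    · exact isClosed_le (by fun_prop) (by fun_prop)
    · exact isClosed_le (by fun_prop) (by fun_prop)
    · exact isClosed_eq (by fun_prop) (by fun_prop)
  · intro x hx
    exact ⟨fun i l => (hx.1 i).1 l, fun i l =>
      (Finset.single_le_sum (fun k _ => (hx.1 i).1 k) (Finset.mem_univ l)).trans (hx.1 i).2⟩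

/-- Leftover objects can always be given away, since there is no overall excess supply. -/
lemma exists_isAllocation_ge {x : I → O → ℝ} (hx : ∀ i, x i ∈ consumptionSpace (Γ.c i))
    (hq : ∀ l, ∑ i, x i l ≤ Γ.q l) : ∃ y, Γ.IsAllocation y ∧ ∀ i, x i ≤ y i := by
  -- agents absorb the leftover `e` in proportion to their slack `s`
  set e : O → ℝ := fun l => Γ.q l - ∑ i, x i l with he
  set s : I → ℝ := fun i => Γ.c i - ∑ l, x i l with hs
  have he0 : ∀ l, 0 ≤ e l := fun l => sub_nonneg.2 (hq l)
  have hs0 : ∀ i, 0 ≤ s i := fun i => sub_nonneg.2 (hx i).2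
  have hes : ∑ l, e l ≤ ∑ i, s i := by
    simp only [he, hs, Finset.sum_sub_distrib]
    rw [Finset.sum_comm]
    linarith [Γ.sum_q_le]
  have hS0 : 0 ≤ ∑ i, s i := Finset.sum_nonneg fun i _ => hs0 i
  have hpos : ∀ i l, 0 ≤ s i * (e l / ∑ i, s i) := fun i l =>
    mul_nonneg (hs0 i) (div_nonneg (he0 l) hS0)
  refine ⟨fun i l => x i l + s i * (e l / ∑ i, s i), ⟨fun i => ⟨fun l => ?_, ?_⟩, fun l => ?_⟩,
    fun i l => le_add_of_nonneg_right (hpos i l)⟩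
  · exact add_nonneg ((hx i).1 l) (hpos i l)
  · rw [Finset.sum_add_distrib, ← Finset.mul_sum, ← Finset.sum_div]
    have h1 := mul_le_of_le_one_right (hs0 i) (div_le_one_of_le₀ hes hS0)
    simp only [hs] at h1 ⊢
    linarith
  · rw [Finset.sum_add_distrib, ← Finset.sum_mul]
    rcases hS0.eq_or_lt with hS | hS
    · have h1 : e l = 0 := le_antisymm ((Finset.single_le_sum (fun k _ => he0 k)
        (Finset.mem_univ l)).trans (hes.trans hS.ge)) (he0 l)
      simp only [he] at h1
      rw [← hS, zero_mul]
      linarith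
    · rw [mul_div_cancel₀ _ hS.ne']
      simp [he]

end Allocations

/-! ### Justified envy at allocations that are efficient for a group -/

section Envy

variable {O I : Type*} [Fintype O] [Fintype I] (Γ : AllocationProblem O I)

/-- Pareto optimality for the group `S` of agents, the other agents being disregarded. -/
def IsParetoOn (S : Set I) (x : I → O → ℝ) : Prop :=
  ∀ y, Γ.IsAllocation y → (∀ i ∈ S, Γ.value i (x i) ≤ Γ.value i (y i)) →
    ∀ i ∈ S, Γ.value i (y i) ≤ Γ.value i (x i)

/-- How far the allocation `x` violates individual rationality for agent `i`, or the absence of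
strong justified envy of agent `i`, where utilities are extended to all bundles. -/
noncomputable def violation (i : I) (x : I → O → ℝ) : ℝ :=
  max (Γ.r i - Γ.value i (x i)) 0 +
    ∑ j, max (min (Γ.value i (x j) - Γ.value i (x i)) (Γ.value j (x i) - Γ.r j)) 0

variable {Γ}

lemma violation_nonneg (i : I) (x : I → O → ℝ) : 0 ≤ Γ.violation i x :=
  add_nonneg (le_max_right _ _) (Finset.sum_nonneg fun _ _ => le_max_right _ _)

lemma violation_eq_zero_iff {i : I} {x : I → O → ℝ} :
    Γ.violation i x = 0 ↔ Γ.r i ≤ Γ.value i (x i) ∧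
      ∀ j, Γ.value i (x i) < Γ.value i (x j) → Γ.value j (x i) ≤ Γ.r j := by
  rw [violation, add_eq_zero_iff_of_nonneg (le_max_right _ _)
    (Finset.sum_nonneg fun _ _ => le_max_right _ _),
    Finset.sum_eq_zero_iff_of_nonneg fun _ _ => le_max_right _ _]
  simp only [max_eq_right_iff, min_le_iff, sub_nonpos, Finset.mem_univ, true_imp_iff]
  refine and_congr_right fun _ => forall_congr' fun j => ?_
  rw [← not_lt (a := Γ.value i (x i)), imp_iff_not_or]

lemma continuousOn_violation (i : I) :
    ContinuousOn (Γ.violation i) {x | Γ.IsAllocation x} := by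
  have h : ∀ j k, ContinuousOn (fun x : I → O → ℝ => Γ.value j (x k)) {x | Γ.IsAllocation x} :=
    fun j k => (continuousOn_value j).comp (continuous_apply k).continuousOn
      fun x hx => hx.nonneg k
  refine ContinuousOn.add ((continuousOn_const.sub (h i i)).sup continuousOn_const)
    (continuousOn_finsetSum _ fun j _ => ContinuousOn.sup
      (ContinuousOn.inf ((h i j).sub (h i i)) ((h j i).sub continuousOn_const)) continuousOn_const)

lemma isIR_of_violation_eq_zero {x : I → O → ℝ} (hx : Γ.IsAllocation x)
    (h : ∀ i, Γ.violation i x = 0) : Γ.IsIR x := fun i => by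
  rw [← coe_value_of_mem (hx.1 i)]
  exact_mod_cast (violation_eq_zero_iff.1 (h i)).1

lemma noStrongJustifiedEnvy_of_violation_eq_zero {x : I → O → ℝ} (hx : Γ.IsAllocation x)
    (h : ∀ i, Γ.violation i x = 0) : Γ.NoStrongJustifiedEnvy x := by
  rintro ⟨i, j, -, h1, h2⟩
  have hj : x j ∈ consumptionSpace (Γ.c i) := mem_consumptionSpace_iff.2 (bot_le.trans_lt h1)
  have hi : x i ∈ consumptionSpace (Γ.c j) := mem_consumptionSpace_iff.2 (bot_le.trans_lt h2)
  rw [← coe_value_of_mem (hx.1 i), ← coe_value_of_mem hj, EReal.coe_lt_coe_iff] at h1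
  rw [← coe_value_of_mem hi, EReal.coe_lt_coe_iff] at h2
  exact h2.not_ge ((violation_eq_zero_iff.1 (h i)).2 j h1)

/-- Permuting the bundles, with disposal of what does not fit, cannot be an improvement for `S`. -/
lemma IsParetoOn.perm {S : Set I} {x : I → O → ℝ} (hS : Γ.IsParetoOn S x) (hx : Γ.IsAllocation x)
    (π : Equiv.Perm I) (hπ : ∀ i ∈ S, Γ.value i (x i) ≤ Γ.value i (x (π i))) :
    ∀ i ∈ S, Γ.value i (x (π i)) ≤ Γ.value i (x i) := by
  have hmem : ∀ i, rescale (Γ.c i) (x (π i)) ∈ consumptionSpace (Γ.c i) := fun i =>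
    rescale_mem (Γ.c_pos i) (hx.nonneg _)
  obtain ⟨y, hy, hxy⟩ := exists_isAllocation_ge hmem fun l => by
    rw [← hx.2 l, ← Equiv.sum_comp π fun i => x i l]
    exact Finset.sum_le_sum fun i _ => rescale_le (Γ.c_pos i) (hx.nonneg _) l
  have hle : ∀ i, Γ.value i (x (π i)) ≤ Γ.value i (y i) := fun i => by
    rw [← value_rescale (hx.nonneg (π i))]
    exact value_mono (hmem i) (hy.1 i) (hxy i)
  exact fun i hi => (hle i).trans (hS y hy (fun j hj => (hπ j hj).trans (hle j)) i hi)

/-- A map of a finite type to itself that leaves `T` invariant permutes some points of `T`. -/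
lemma exists_perm_of_mapsTo {I : Type*} [Finite I] (f : I → I) {T : Set I} (hT : T.Nonempty)
    (hf : Set.MapsTo f T T) :
    ∃ π : Equiv.Perm I, (∀ i, π i = f i ∨ π i = i) ∧ ∃ i ∈ T, π i = f i := by
  classical
  obtain ⟨i₀, hi₀⟩ := hT
  have hiter : ∀ n, f^[n] i₀ ∈ T := fun n => hf.iterate n hi₀
  obtain ⟨i, hiT, hi⟩ : ∃ i ∈ T, i ∈ Function.periodicPts f := by
    obtain ⟨a, b, hab, h⟩ := Finite.exists_ne_map_eq_of_infinite fun n : ℕ => f^[n] i₀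
    wlog hlt : a < b generalizing a b
    · exact this b a hab.symm h.symm (lt_of_le_of_ne (not_lt.1 hlt) hab.symm)
    refine ⟨f^[a] i₀, hiter a, Function.mk_mem_periodicPts (n := b - a) (by omega) ?_⟩
    change f^[b - a] (f^[a] i₀) = f^[a] i₀
    rw [← Function.iterate_add_apply, Nat.sub_add_cancel hlt.le]
    exact h.symm
  have hbij := Function.bijOn_periodicPts f
  let g : I → I := fun i => if i ∈ Function.periodicPts f then f i else i
  have hg : Function.Injective g := by
    intro i j hij
    by_cases hi : i ∈ Function.periodicPts f <;> by_cases hj : j ∈ Function.periodicPts f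
    · simp only [g, hi, hj, if_true] at hij
      exact hbij.injOn hi hj hij
    · simp only [g, hi, hj, if_true, if_false] at hij
      exact absurd (hij ▸ hbij.mapsTo hi) hj
    · simp only [g, hi, hj, if_true, if_false] at hij
      exact absurd (hij ▸ hbij.mapsTo hj) hi
    · simpa only [g, hi, hj, if_false] using hij
  refine ⟨Equiv.ofBijective g (Finite.injective_iff_bijective.1 hg), fun j => ?_, i, hiT, ?_⟩
  · by_cases hj : j ∈ Function.periodicPts f
    · exact Or.inl (if_pos hj)
    · exact Or.inr (if_neg hj)
  · exact if_pos hi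

/-- If `x` is Pareto optimal for a group, some member of the group has nothing to complain about.
Indeed, justified envy among the members who reach their reservation utility would lead along a
cycle, and that of such a member towards anyone else would be remedied by a swap. -/
lemma IsParetoOn.exists_violation_eq_zero {S : Set I} {x : I → O → ℝ} (hS : Γ.IsParetoOn S x)
    (hne : S.Nonempty) (hx : Γ.IsAllocation x) (hIR : ∃ y, Γ.IsAllocation y ∧ Γ.IsIR y) :
    ∃ i ∈ S, Γ.violation i x = 0 := by
  classical
  set T : Set I := {i | i ∈ S ∧ Γ.r i ≤ Γ.value i (x i)} with hT
  have hTne : T.Nonempty := by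
    by_contra hemp
    have hlt : ∀ i ∈ S, Γ.value i (x i) < Γ.r i := fun i hi => by
      by_contra! h
      exact hemp ⟨i, hi, h⟩
    obtain ⟨y, hy, hyIR⟩ := hIR
    have hyr : ∀ i, Γ.r i ≤ Γ.value i (y i) := fun i => by
      have := hyIR i
      rw [← coe_value_of_mem (hy.1 i)] at this
      exact_mod_cast this
    obtain ⟨i, hi⟩ := hne
    have := hS y hy (fun j hj => (hlt j hj).le.trans (hyr j)) i hi
    linarith [hlt i hi, hyr i]
  by_contra! hcon
  have henvy : ∀ i, ∃ j, i ∈ T → Γ.value i (x i) < Γ.value i (x j) ∧ Γ.r j < Γ.value j (x i) := by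
    intro i
    by_cases hi : i ∈ T
    · have := hcon i hi.1
      rw [Ne, violation_eq_zero_iff] at this
      push Not at this
      obtain ⟨j, hj⟩ := this hi.2
      exact ⟨j, fun _ => hj⟩
    · exact ⟨i, fun h => absurd h hi⟩
  choose f₀ hf₀ using henvy
  let f : I → I := fun i => if i ∈ T then f₀ i else i
  have hf : ∀ i ∈ T, f i = f₀ i := fun i hi => if_pos hi
  have hmaps : Set.MapsTo f T T := by
    intro i hi
    rw [hf i hi]
    by_contra hj
    obtain ⟨h1, h2⟩ := hf₀ i hi
    have hij : f₀ i ≠ i := fun h => by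
      rw [h] at h1
      exact lt_irrefl _ h1
    -- the envied agent is disregarded, or below her reservation utility and so envies `i` back
    have := hS.perm hx (Equiv.swap i (f₀ i)) (fun k hk => ?_) i hi.1
    · rw [Equiv.swap_apply_left] at this
      exact h1.not_ge this
    · by_cases hki : k = i
      · rw [hki, Equiv.swap_apply_left]
        exact h1.le
      by_cases hkj : k = f₀ i
      · rw [hkj, Equiv.swap_apply_right]
        have : Γ.value (f₀ i) (x (f₀ i)) < Γ.r (f₀ i) := by
          by_contra! h
          exact hj ⟨hkj ▸ hk, h⟩
        exact (this.trans h2).le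
      · rw [Equiv.swap_apply_of_ne_of_ne hki hkj]
  obtain ⟨π, hπ, i, hi, hπi⟩ := exists_perm_of_mapsTo f hTne hmaps
  have := hS.perm hx π (fun k _ => ?_) i hi.1
  · rw [hπi, hf i hi] at this
    exact (hf₀ i hi).1.not_ge this
  · rcases hπ k with h | h
    · rw [h]
      by_cases hk : k ∈ T
      · rw [hf k hk]
        exact (hf₀ k hk).1.le
      · simp only [f, hk, if_false, le_refl]
    · rw [h]

/-- If the violations are proportional to weights, and `x` is Pareto optimal for the agents of
positive weight, then there are no violations: an agent of positive weight has none. -/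
lemma IsParetoOn.violation_eq_zero {t : I → ℝ} (ht : t ∈ stdSimplex ℝ I) {x : I → O → ℝ}
    (hx : Γ.IsAllocation x) (hS : Γ.IsParetoOn {i | 0 < t i} x)
    (hIR : ∃ y, Γ.IsAllocation y ∧ Γ.IsIR y)
    (heq : ∀ i, Γ.violation i x = t i * ∑ k, Γ.violation k x) (i : I) :
    Γ.violation i x = 0 := by
  obtain ⟨j, hj, hj0⟩ := hS.exists_violation_eq_zero (exists_pos_of_mem_stdSimplex ht) hx hIR
  have h : ∑ k, Γ.violation k x = 0 :=
    (mul_eq_zero.1 ((heq j).symm.trans hj0)).resolve_left (ne_of_gt hj)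
  rw [heq i, h, mul_zero]

end Envy

end AllocationProblem

/-! ### Welfare maximizing allocations without violations -/

lemma strictConcaveOn_neg_sum_sq (O I : Type*) [Fintype O] [Fintype I] :
    StrictConcaveOn ℝ Set.univ fun x : I → O → ℝ => -∑ i, ∑ l, x i l ^ 2 := by
  refine ⟨convex_univ, fun x _ y _ hxy a b ha hb hab => ?_⟩
  obtain ⟨i, hi⟩ := Function.ne_iff.1 hxy
  obtain ⟨l, hl⟩ := Function.ne_iff.1 hi
  have hid : ∀ i l, a * x i l ^ 2 + b * y i l ^ 2 - (a * x i l + b * y i l) ^ 2 =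
      a * b * (x i l - y i l) ^ 2 := fun i l => by
    rw [show b = 1 - a by linarith]
    ring
  have h1 : 0 < ∑ i, ∑ l, (a * x i l ^ 2 + b * y i l ^ 2 - (a * x i l + b * y i l) ^ 2) := by
    simp only [hid]
    have hnn : ∀ i l, 0 ≤ a * b * (x i l - y i l) ^ 2 := fun i l => by positivity
    refine Finset.sum_pos' (fun i _ => Finset.sum_nonneg fun l _ => hnn i l)
      ⟨i, Finset.mem_univ _, Finset.sum_pos' (fun l _ => hnn i l) ⟨l, Finset.mem_univ _, ?_⟩⟩
    have := sub_ne_zero.2 hl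
    positivity
  simp only [Finset.sum_sub_distrib, Finset.sum_add_distrib, ← Finset.mul_sum] at h1
  simp only [smul_eq_mul, Pi.add_apply, Pi.smul_apply]
  linarith

namespace AllocationProblem

variable {O I : Type*} [Fintype O] [Fintype I] {Γ : AllocationProblem O I}

/-- For any weights that depend continuously on a point of the simplex, there are a point `t` and
an allocation of maximal weighted welfare at which the violations are proportional to `t`. -/
lemma exists_isMaxOn_violation_eq [Nonempty I] (hconcave : ∀ i, IsConcaveUtility (Γ.u i))
    (hne : ∃ x, Γ.IsAllocation x) (w : (I → ℝ) → I → ℝ) (hw : Continuous w)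
    (hw0 : ∀ t ∈ stdSimplex ℝ I, ∀ i, 0 ≤ w t i) :
    ∃ t ∈ stdSimplex ℝ I, ∃ x, Γ.IsAllocation x ∧
      (∀ y, Γ.IsAllocation y →
        ∑ i, w t i * Γ.value i (y i) ≤ ∑ i, w t i * Γ.value i (x i)) ∧
      ∀ i, Γ.violation i x = t i * ∑ k, Γ.violation k x := by
  have hval : ∀ i, ContinuousOn (fun p : (I → ℝ) × (I → O → ℝ) => Γ.value i (p.2 i))
      (stdSimplex ℝ I ×ˢ {x | Γ.IsAllocation x}) := fun i =>
    (continuousOn_value i).comp (f := fun p : (I → ℝ) × (I → O → ℝ) => p.2 i) (by fun_prop)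
      fun p hp => IsAllocation.nonneg hp.2 i
  obtain ⟨t, ht, x, hx, hmax, heq⟩ := exists_isMaxOn_eq_mul_sum (Γ.isCompact_isAllocation) hne
    (fun t x => ∑ i, w t i * Γ.value i (x i))
    (continuousOn_finsetSum _ fun i _ =>
      (((continuous_apply i).comp (hw.comp continuous_fst)).continuousOn).mul (hval i))
    (fun t ht => ⟨Γ.convex_isAllocation, fun x hx y hy a b ha hb hab => by
      have hxy := Γ.convex_isAllocation hx hy ha hb hab
      simp only [smul_eq_mul, Finset.mul_sum]
      rw [← Finset.sum_add_distrib]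
      refine Finset.sum_le_sum fun i _ => ?_
      have h1 := mul_le_mul_of_nonneg_left (value_concave (hconcave i) (hx.1 i) (hy.1 i) ha hb hab
        (hxy.1 i)) (hw0 t ht i)
      calc a * (w t i * Γ.value i (x i)) + b * (w t i * Γ.value i (y i))
          = w t i * (a * Γ.value i (x i) + b * Γ.value i (y i)) := by ring
        _ ≤ _ := h1⟩)
    (by fun_prop : ContinuousOn (fun x : I → O → ℝ => -∑ i, ∑ l, x i l ^ 2) _)
    ((strictConcaveOn_neg_sum_sq O I).subset (Set.subset_univ _) Γ.convex_isAllocation)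
    Γ.violation continuousOn_violation (fun i x _ => violation_nonneg i x)
  exact ⟨t, ht, x, hx, fun y hy => isMaxOn_iff.1 hmax y hy, heq⟩

lemma IsParetoOn.isWeaklyPO {S : Set I} {x : I → O → ℝ} (hS : Γ.IsParetoOn S x)
    (hne : S.Nonempty) (hx : Γ.IsAllocation x) : Γ.IsWeaklyPO x := by
  rintro ⟨y, hy, h⟩
  have hlt : ∀ i, Γ.value i (x i) < Γ.value i (y i) := fun i => by
    have := h i
    rwa [← coe_value_of_mem (hx.1 i), ← coe_value_of_mem (hy.1 i), EReal.coe_lt_coe_iff] at this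
  obtain ⟨i, hi⟩ := hne
  exact (hlt i).not_ge (hS y hy (fun i _ => (hlt i).le) i hi)

lemma IsParetoOn.isPO {x : I → O → ℝ} (hS : Γ.IsParetoOn Set.univ x) (hx : Γ.IsAllocation x) :
    Γ.IsPO x := by
  rintro ⟨y, hy, h, i, hi⟩
  have hle : ∀ i, Γ.value i (x i) ≤ Γ.value i (y i) := fun i => by
    have := h i
    rwa [← coe_value_of_mem (hx.1 i), ← coe_value_of_mem (hy.1 i), EReal.coe_le_coe_iff] at this
  rw [← coe_value_of_mem (hx.1 i), ← coe_value_of_mem (hy.1 i), EReal.coe_lt_coe_iff] at hi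
  exact hi.not_ge (hS y hy (fun i _ => hle i) i (Set.mem_univ i))

/-- Weighted welfare with the weights `t` themselves yields weak Pareto optimality. -/
theorem exists_isIR_isWeaklyPO [Nonempty I] (hconcave : ∀ i, IsConcaveUtility (Γ.u i))
    (hIR : ∃ x, Γ.IsAllocation x ∧ Γ.IsIR x) :
    ∃ x, Γ.IsAllocation x ∧ Γ.IsIR x ∧ Γ.IsWeaklyPO x ∧ Γ.NoStrongJustifiedEnvy x := by
  obtain ⟨t, ht, x, hx, hmax, heq⟩ := exists_isMaxOn_violation_eq hconcave
    (hIR.imp fun _ h => h.1) id continuous_id fun t ht i => ht.1 i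
  have hS : Γ.IsParetoOn {i | 0 < t i} x := by
    intro y hy hle i hi
    by_contra! hlt
    refine (hmax y hy).not_gt (Finset.sum_lt_sum (fun j _ => ?_)
      ⟨i, Finset.mem_univ i, mul_lt_mul_of_pos_left hlt hi⟩)
    rcases (ht.1 j).eq_or_lt with h | h
    · simp [← h]
    · exact mul_le_mul_of_nonneg_left (hle j h) (ht.1 j)
  have hzero := hS.violation_eq_zero ht hx hIR heq
  exact ⟨x, hx, isIR_of_violation_eq_zero hx hzero,
    hS.isWeaklyPO (exists_pos_of_mem_stdSimplex ht) hx,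
    noStrongJustifiedEnvy_of_violation_eq_zero hx hzero⟩

/-! ### Linear utilities -/

/-- The direction from a limit of allocations to an allocation `y` is eventually feasible at the
members of the sequence, half the way: the allocations form a polytope. -/
lemma eventually_isAllocation_add_half {ι : Type*} {l : Filter ι} {ξ : ι → I → O → ℝ}
    {x y : I → O → ℝ} (hξ : ∀ n, Γ.IsAllocation (ξ n)) (hx : Γ.IsAllocation x)
    (hlim : Filter.Tendsto ξ l (nhds x)) (hy : Γ.IsAllocation y) :
    ∀ᶠ n in l, Γ.IsAllocation (ξ n + (1 / 2 : ℝ) • (y - x)) := by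
  have hcoord : ∀ i k, Filter.Tendsto (fun n => ξ n i k) l (nhds (x i k)) := fun i k =>
    tendsto_pi_nhds.1 (tendsto_pi_nhds.1 hlim i) k
  -- a linear constraint is either inactive at the limit, or satisfied by the direction
  have key : ∀ (α : ι → ℝ) (a b : ℝ), Filter.Tendsto α l (nhds a) → (∀ n, 0 ≤ α n) → 0 ≤ a →
      0 ≤ b → ∀ᶠ n in l, 0 ≤ α n + 1 / 2 * (b - a) := by
    intro α a b hα hα0 ha hb
    rcases ha.eq_or_lt with rfl | ha
    · exact Filter.Eventually.of_forall fun n => by linarith [hα0 n]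
    · filter_upwards [hα.eventually (lt_mem_nhds (half_lt_self ha))] with n hn
      linarith
  have h1 : ∀ᶠ n in l, ∀ i k, 0 ≤ ξ n i k + 1 / 2 * (y i k - x i k) := by
    simp only [Filter.eventually_all]
    exact fun i k => key _ _ _ (hcoord i k) (fun n => ((hξ n).1 i).1 k) ((hx.1 i).1 k)
      ((hy.1 i).1 k)
  have h2 : ∀ᶠ n in l, ∀ i, 0 ≤ (Γ.c i - ∑ k, ξ n i k) +
      1 / 2 * ((Γ.c i - ∑ k, y i k) - (Γ.c i - ∑ k, x i k)) := by
    rw [Filter.eventually_all]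
    exact fun i => key _ _ _ (tendsto_const_nhds.sub (tendsto_finsetSum _ fun k _ => hcoord i k))
      (fun n => sub_nonneg.2 ((hξ n).1 i).2) (sub_nonneg.2 (hx.1 i).2) (sub_nonneg.2 (hy.1 i).2)
  filter_upwards [h1, h2] with n hn1 hn2
  refine ⟨fun i => ⟨fun k => hn1 i k, ?_⟩, fun k => ?_⟩
  · have := hn2 i
    simp only [Pi.add_apply, Pi.smul_apply, Pi.sub_apply, smul_eq_mul, Finset.sum_add_distrib,
      ← Finset.mul_sum, Finset.sum_sub_distrib]
    linarith
  · simp only [Pi.add_apply, Pi.smul_apply, Pi.sub_apply, smul_eq_mul, Finset.sum_add_distrib,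
      ← Finset.mul_sum, Finset.sum_sub_distrib, (hξ n).2 k, hx.2 k, hy.2 k]
    ring

/-- With linear utilities, if `ξ n` maximizes welfare for the weights `w n` and tends to `x`, then
for each allocation `y`, the welfare of `x` for the weights `w n` is eventually at least that of
`y`. -/
lemma eventually_sum_mul_sub_nonpos (hlin : ∀ i, IsLinearUtility (Γ.u i)) {ι : Type*}
    {l : Filter ι} {ξ : ι → I → O → ℝ} {w : ι → I → ℝ} {x y : I → O → ℝ}
    (hξ : ∀ n, Γ.IsAllocation (ξ n)) (hx : Γ.IsAllocation x)
    (hlim : Filter.Tendsto ξ l (nhds x)) (hy : Γ.IsAllocation y)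
    (hmax : ∀ n z, Γ.IsAllocation z →
      ∑ i, w n i * Γ.value i (z i) ≤ ∑ i, w n i * Γ.value i (ξ n i)) :
    ∀ᶠ n in l, ∑ i, w n i * (Γ.value i (y i) - Γ.value i (x i)) ≤ 0 := by
  choose v hv using fun i => exists_value_eq_sum (hlin i)
  filter_upwards [eventually_isAllocation_add_half hξ hx hlim hy] with n hn
  have h1 : ∀ i, Γ.value i ((ξ n + (1 / 2 : ℝ) • (y - x)) i) =
      Γ.value i (ξ n i) + 1 / 2 * (Γ.value i (y i) - Γ.value i (x i)) := by
    intro i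
    rw [hv i _ (hn.1 i), hv i _ ((hξ n).1 i), hv i _ (hy.1 i), hv i _ (hx.1 i),
      ← Finset.sum_sub_distrib, Finset.mul_sum, ← Finset.sum_add_distrib]
    refine Finset.sum_congr rfl fun k _ => ?_
    simp only [Pi.add_apply, Pi.smul_apply, Pi.sub_apply, smul_eq_mul]
    ring
  have h2 := hmax n _ hn
  have h3 : ∑ i, w n i * Γ.value i ((ξ n + (1 / 2 : ℝ) • (y - x)) i) =
      ∑ i, w n i * Γ.value i (ξ n i) +
        1 / 2 * ∑ i, w n i * (Γ.value i (y i) - Γ.value i (x i)) := by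
    rw [Finset.mul_sum, ← Finset.sum_add_distrib]
    refine Finset.sum_congr rfl fun i _ => ?_
    rw [h1]
    ring
  linarith

/-- The weights `exp (n * t i)` are all positive, which yields Pareto optimality in the limit
`n → ∞`, but those outside the support of the limit of `t` become negligible. -/
theorem exists_isIR_isPO [Nonempty I] (hconcave : ∀ i, IsConcaveUtility (Γ.u i))
    (hIR : ∃ x, Γ.IsAllocation x ∧ Γ.IsIR x) (hlin : ∀ i, IsLinearUtility (Γ.u i)) :
    ∃ x, Γ.IsAllocation x ∧ Γ.IsIR x ∧ Γ.IsPO x ∧ Γ.NoStrongJustifiedEnvy x := by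
  choose τ hτ ξ hξ hmax heq using fun n : ℕ => exists_isMaxOn_violation_eq hconcave
    (hIR.imp fun _ h => h.1) (fun t i => Real.exp (n * t i)) (by fun_prop)
    fun t _ i => (Real.exp_pos _).le
  obtain ⟨⟨t, x⟩, ⟨ht, hx⟩, φ, hφ, hlim⟩ :=
    ((isCompact_stdSimplex ℝ I).prod Γ.isCompact_isAllocation).tendsto_subseq
      (x := fun n => (τ n, ξ n)) fun n => ⟨hτ n, hξ n⟩
  change Γ.IsAllocation x at hx
  have hlim1 : ∀ i, Filter.Tendsto (fun n => τ (φ n) i) Filter.atTop (nhds (t i)) :=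
    tendsto_pi_nhds.1 ((continuous_fst.tendsto _).comp hlim)
  have hlim2 : Filter.Tendsto (fun n => ξ (φ n)) Filter.atTop (nhds x) :=
    (continuous_snd.tendsto _).comp hlim
  have hev : ∀ y, Γ.IsAllocation y → ∀ᶠ n in Filter.atTop,
      ∑ i, Real.exp (φ n * τ (φ n) i) * (Γ.value i (y i) - Γ.value i (x i)) ≤ 0 := fun y hy =>
    eventually_sum_mul_sub_nonpos hlin (fun n => hξ (φ n)) hx hlim2 hy fun n => hmax (φ n)
  have hPO : Γ.IsParetoOn Set.univ x := by
    intro y hy hle i _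
    by_contra! hlt
    obtain ⟨n, hn⟩ := (hev y hy).exists
    refine hn.not_gt (Finset.sum_pos' (fun j _ => ?_) ⟨i, Finset.mem_univ i, ?_⟩)
    · exact mul_nonneg (Real.exp_pos _).le (sub_nonneg.2 (hle j (Set.mem_univ j)))
    · exact mul_pos (Real.exp_pos _) (sub_pos.2 hlt)
  have hS : Γ.IsParetoOn {i | 0 < t i} x := by
    intro y hy hle i hi
    rw [← sub_nonpos]
    -- compare with `i` the agents of zero weight only; the others do not lose
    have hlimit : Filter.Tendsto (fun n => ∑ j ∈ Finset.univ.filter fun j => t j = 0,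
        -(Real.exp (φ n * (τ (φ n) j - τ (φ n) i)) * (Γ.value j (y j) - Γ.value j (x j))))
        Filter.atTop (nhds 0) := by
      have hterm : ∀ j ∈ Finset.univ.filter fun j => t j = 0, Filter.Tendsto (fun n =>
          -(Real.exp (φ n * (τ (φ n) j - τ (φ n) i)) * (Γ.value j (y j) - Γ.value j (x j))))
          Filter.atTop (nhds 0) := by
        intro j hj
        have hj0 : t j = 0 := by simpa using hj
        have hneg : t j - t i < 0 := by
          rw [hj0]
          exact sub_neg.2 hi
        have h1 := Filter.Tendsto.atTop_mul_neg hneg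
          (tendsto_natCast_atTop_atTop (R := ℝ) |>.comp hφ.tendsto_atTop)
          ((hlim1 j).sub (hlim1 i))
        simpa using ((Real.tendsto_exp_atBot.comp h1).mul_const
          (Γ.value j (y j) - Γ.value j (x j))).neg
      simpa using tendsto_finsetSum _ hterm
    refine ge_of_tendsto hlimit ((hev y hy).mono fun n hn => ?_)
    have hdiv : ∑ j, Real.exp (φ n * (τ (φ n) j - τ (φ n) i)) *
        (Γ.value j (y j) - Γ.value j (x j)) ≤ 0 := by
      have h1 : ∀ j, Real.exp (φ n * (τ (φ n) j - τ (φ n) i)) *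
          (Γ.value j (y j) - Γ.value j (x j)) = Real.exp (-(φ n * τ (φ n) i)) *
          (Real.exp (φ n * τ (φ n) j) * (Γ.value j (y j) - Γ.value j (x j))) := fun j => by
        rw [← mul_assoc, ← Real.exp_add]
        congr 2
        ring
      simp only [h1, ← Finset.mul_sum]
      exact mul_nonpos_of_nonneg_of_nonpos (Real.exp_pos _).le hn
    rw [← Finset.sum_filter_add_sum_filter_not Finset.univ fun j => t j = 0] at hdiv
    have hi' : Γ.value i (y i) - Γ.value i (x i) ≤
        ∑ j ∈ Finset.univ.filter fun j => ¬ t j = 0,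
          Real.exp (φ n * (τ (φ n) j - τ (φ n) i)) * (Γ.value j (y j) - Γ.value j (x j)) := by
      have h1 := Finset.single_le_sum (f := fun j => Real.exp (φ n * (τ (φ n) j - τ (φ n) i)) *
        (Γ.value j (y j) - Γ.value j (x j))) (s := Finset.univ.filter fun j => ¬ t j = 0)
        (fun j hj => mul_nonneg (Real.exp_pos _).le (sub_nonneg.2 (hle j
          (lt_of_le_of_ne (ht.1 j) (Ne.symm (by simpa using hj))))))
        (by simpa using (ne_of_gt hi : t i ≠ 0) : i ∈ _)
      simpa using h1
    rw [Finset.sum_neg_distrib]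
    linarith
  have hd : ∀ k, Filter.Tendsto (fun n => Γ.violation k (ξ (φ n))) Filter.atTop
      (nhds (Γ.violation k x)) := fun k =>
    (continuousOn_violation k x hx).tendsto.comp (tendsto_nhdsWithin_iff.2
      ⟨hlim2, Filter.Eventually.of_forall fun n => hξ _⟩)
  have hzero := hS.violation_eq_zero ht hx hIR fun i => by
    refine tendsto_nhds_unique (hd i) ?_
    simp only [heq _ i]
    exact (hlim1 i).mul (tendsto_finsetSum _ fun k _ => hd k)
  exact ⟨x, hx, isIR_of_violation_eq_zero hx hzero, hPO.isPO hx,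
    noStrongJustifiedEnvy_of_violation_eq_zero hx hzero⟩

/-! ### Lower reservation utilities -/

/-- The allocation problem with all reservation utilities lowered by `ε`. -/
def lowerReservation (Γ : AllocationProblem O I) (ε : ℝ) : AllocationProblem O I :=
  { Γ with r := fun i => Γ.r i - ε }

lemma IsWeaklyPO.isEpsPO {x : I → O → ℝ} (h : Γ.IsWeaklyPO x) {ε : ℝ} (hε : 0 < ε) :
    Γ.IsEpsPO ε x := by
  rintro ⟨y, hy, hlt⟩
  refine h ⟨y, hy, fun i => lt_of_le_of_lt ?_ (hlt i)⟩
  exact le_add_of_nonneg_right (by exact_mod_cast hε.le)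

end AllocationProblem

theorem theorem1 {O I : Type*} [Fintype O] [Fintype I] [Nonempty I]
    (Γ : AllocationProblem O I)
    (hconcave : ∀ i, IsConcaveUtility (Γ.u i))
    (hIR : ∃ x, Γ.IsAllocation x ∧ Γ.IsIR x) :
    (∀ ε : ℝ, 0 < ε →
      ∃ x, Γ.IsAllocation x ∧ Γ.IsEpsIR ε x ∧ Γ.IsEpsPO ε x ∧ Γ.NoEpsJustifiedEnvy ε x) ∧
    (∃ x, Γ.IsAllocation x ∧ Γ.IsIR x ∧ Γ.IsWeaklyPO x ∧ Γ.NoStrongJustifiedEnvy x) ∧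
    ((∀ i, IsLinearUtility (Γ.u i)) →
      ∃ x, Γ.IsAllocation x ∧ Γ.IsIR x ∧ Γ.IsPO x ∧ Γ.NoStrongJustifiedEnvy x) := by
  refine ⟨fun ε hε => ?_, AllocationProblem.exists_isIR_isWeaklyPO hconcave hIR,
    AllocationProblem.exists_isIR_isPO hconcave hIR⟩
  have hIR' : ∃ x, (Γ.lowerReservation ε).IsAllocation x ∧ (Γ.lowerReservation ε).IsIR x := by
    obtain ⟨x, hx, hxr⟩ := hIR
    refine ⟨x, hx, fun i => le_trans ?_ (hxr i)⟩
    exact EReal.coe_le_coe_iff.2 (sub_le_self _ hε.le)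
  obtain ⟨x, hx, hr, hPO, henvy⟩ :=
    AllocationProblem.exists_isIR_isWeaklyPO (Γ := Γ.lowerReservation ε) hconcave hIR'
  exact ⟨x, hx, hr, AllocationProblem.IsWeaklyPO.isEpsPO (Γ := Γ) hPO hε, henvy⟩
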